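/- Let $\Lambda R$ be the cyclotomic category: its objects are the wheels $[n]$, $n\ge 1$ (a circle with $n$ marked points, called vertices), and its morphisms $[m]\to[n]$ are homotopy classes of monotone continuous maps of circles of degree $\ge 1$ that send marked points to marked points; equivalently, classes of non-decreasing maps $f:\mathbb Z\to\mathbb Z$ such that $f(a+m)=f(a)+ln$ for all $a$, with some $l\ge 1$ (the degree), modulo $f\sim f+kn$, $k\in\mathbb Z$. Let $V:\Lambda R\to\mathrm{Sets}$ be the functor sending $[n]$ to its set of vertices, $V([n])=\mathbb Z/n$, and let $\tilde\jmath:\Delta R\to\Lambda R^{opp}$ be the discrete fibration obtained from $V$ by the Grothendieck construction: objects of $\Delta R$ are pairs $([n],v)$ with $v\in V([n])$, and morphisms $([n],v)\to([m],w)$ are morphisms $f:[m]\to[n]$ in $\Lambda R$ with $V(f)(w)=v$. For a small category $C$ and a functor $M$ from $C$ to abelian groups, let $H^i(C,M)=R^i\lim_C M=\mathrm{Ext}^i_{\mathrm{Fun}(C,\mathbb Z)}(\mathbb Z,M)$, and call $M$ profinitely complete if for every object $c$ of $C$ the natural map $M(c)\to\lim_{n\ge 1}M(c)/nM(c)$ (limit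 over divisibility) is an isomorphism. (i) For every profinitely complete functor $M$ from $\Lambda R^{opp}$ to abelian groups, the natural map $$H^i(\Lambda R^{opp},M)\to H^i(\Delta R,\tilde\jmath^*M)$$ induced by pullback along $\tilde\jmath$ is an isomorphism for every $i\ge 0$. (ii) Let $[1/\mathbb N^*]$ be the category with one object whose endomorphism monoid is the multiplicative monoid $\mathbb N^*$ of positive integers, and let $\mathbb Z(1)$ be the functor on it with value $\mathbb Z$ on which $n\in\mathbb N^*$ acts as multiplication by $n$. For every profinitely complete functor $N$ from $[1/\mathbb N^*]$ to abelian groups, $H^i([1/\mathbb N^*],N\otimes\mathbb Z(1))=0$ for every $i\ge 0$. -/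

import Mathlib

open CategoryTheory CategoryTheory.Abelian MonoidalCategory

/-! ### The cyclotomic category

An object `[n]`, `n ≥ 1`, is a circle with `n` marked points (a wheel with `n` vertices).
The preimage of the marked points in the universal cover is identified with `ℤ` in such a way that
the generator of the group of deck transformations acts as `a ↦ a + n`. -/

/-- An object `[n]`, `n ≥ 1`, of the cyclotomic category `ΛR`. -/
structure LambdaR : Type where
  /-- the number of vertices of the wheel -/
  size : ℕ+

namespace LambdaR

/-- The lift to universal covers of a monotone map `[m] → [n]` of degree `degree ≥ 1` that sends
marked points to marked points, recorded by its values on marked points: a monotone map `f : ℤ → ℤ`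
such that `f (a + m) = f a + degree * n`. -/
@[ext]
structure Lift (m n : LambdaR) : Type where
  toFun : ℤ → ℤ
  degree : ℕ+
  monotone' : Monotone toFun
  map_add_size' : ∀ a : ℤ, toFun (a + (m.size : ℤ)) = toFun a + (degree : ℤ) * (n.size : ℤ)

namespace Lift

/-- The identity map of `[n]`. -/
def id (n : LambdaR) : Lift n n where
  toFun a := a
  degree := 1
  monotone' _ _ h := h
  map_add_size' a := by simp

theorem map_add_mul {m n : LambdaR} (f : Lift m n) (a k : ℤ) :
    f.toFun (a + k * (m.size : ℤ)) = f.toFun a + k * ((f.degree : ℤ) * (n.size : ℤ)) := by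
  induction k using Int.induction_on with
  | zero => simp
  | succ i ih =>
    have h := f.map_add_size' (a + (i : ℤ) * (m.size : ℤ))
    rw [ih] at h
    rw [show a + ((i : ℤ) + 1) * (m.size : ℤ) = a + (i : ℤ) * (m.size : ℤ) + (m.size : ℤ) by ring, h]
    ring
  | pred i ih =>
    have h := f.map_add_size' (a + (-(i : ℤ) - 1) * (m.size : ℤ))
    rw [show a + (-(i : ℤ) - 1) * (m.size : ℤ) + (m.size : ℤ) = a + -(i : ℤ) * (m.size : ℤ) by ring,
      ih] at h
    linarith

/-- The composition `[m] → [n] → [p]` (in diagrammatic order); degrees multiply. -/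
def comp {m n p : LambdaR} (f : Lift m n) (g : Lift n p) : Lift m p where
  toFun a := g.toFun (f.toFun a)
  degree := f.degree * g.degree
  monotone' _ _ h := g.monotone' (f.monotone' h)
  map_add_size' a := by
    rw [f.map_add_size', g.map_add_mul]
    push_cast
    ring

/-- Two lifts represent the same homotopy class of maps of circles if and only if they differ by a
deck transformation of the universal cover of the target. -/
instance setoid (m n : LambdaR) : Setoid (Lift m n) where
  r f g := ∃ k : ℤ, ∀ a : ℤ, g.toFun a = f.toFun a + k * (n.size : ℤ)
  iseqv :=
    { refl := fun f => ⟨0, fun a => by simp⟩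
      symm := fun {f g} ⟨k, hk⟩ => ⟨-k, fun a => by rw [hk a]; ring⟩
      trans := fun {f g h} ⟨k, hk⟩ ⟨l, hl⟩ => ⟨k + l, fun a => by rw [hl a, hk a]; ring⟩ }

theorem comp_equiv {m n p : LambdaR} {f f' : Lift m n} {g g' : Lift n p}
    (hf : f ≈ f') (hg : g ≈ g') : f.comp g ≈ f'.comp g' := by
  obtain ⟨k, hk⟩ := hf
  obtain ⟨l, hl⟩ := hg
  refine ⟨k * (g.degree : ℤ) + l, fun a => ?_⟩
  change g'.toFun (f'.toFun a) = g.toFun (f.toFun a) + _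
  rw [hl, hk, g.map_add_mul]
  ring

end Lift

/-- Morphisms `[m] → [n]` in `ΛR`: homotopy classes of monotone maps of circles of degree `≥ 1`
sending marked points to marked points. -/
def Hom (m n : LambdaR) : Type := Quotient (Lift.setoid m n)

instance : SmallCategory LambdaR where
  Hom := Hom
  id n := Quotient.mk _ (Lift.id n)
  comp f g := Quotient.map₂ Lift.comp (fun _ _ hf _ _ hg => Lift.comp_equiv hf hg) f g
  id_comp f := by
    induction f using Quotient.inductionOn
    exact Quotient.sound ⟨0, fun a => by simp [Lift.comp, Lift.id]⟩
  comp_id f := by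
    induction f using Quotient.inductionOn
    exact Quotient.sound ⟨0, fun a => by simp [Lift.comp, Lift.id]⟩
  assoc f g h := by
    induction f using Quotient.inductionOn
    induction g using Quotient.inductionOn
    induction h using Quotient.inductionOn
    exact Quotient.sound ⟨0, fun a => by simp [Lift.comp]⟩

theorem Lift.cast_toFun_eq {m n : LambdaR} (f : Lift m n) {a b : ℤ}
    (h : (a : ZMod m.size) = (b : ZMod m.size)) :
    ((f.toFun a : ℤ) : ZMod n.size) = ((f.toFun b : ℤ) : ZMod n.size) := by
  obtain ⟨k, hk⟩ := (ZMod.intCast_eq_intCast_iff_dvd_sub a b _).1 h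
  have hb : b = a + k * (m.size : ℤ) := by
    have : b - a = (m.size : ℤ) * k := hk
    linarith
  rw [hb, f.map_add_mul]
  push_cast
  simp

theorem intCast_val_eq {n : ℕ+} (v : ZMod n) : (((v.val : ℕ) : ℤ) : ZMod n) = v := by
  have : NeZero (n : ℕ) := ⟨n.ne_zero⟩
  simp

/-- The functor `V : ΛR → Sets` sending a wheel `[n]` to the set `ℤ/n` of its vertices
(the orbits of deck transformations on the preimages of the vertices in the universal cover). -/
def vertices : LambdaR ⥤ Type where
  obj n := ZMod n.size
  map {m n} f := TypeCat.ofHom fun v => Quotient.liftOn f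
    (fun g : Lift m n => ((g.toFun ((v.val : ℕ) : ℤ) : ℤ) : ZMod n.size))
    (by
      rintro g g' ⟨k, hk⟩
      rw [hk]
      push_cast
      simp)
  map_id n := by
    ext v
    exact intCast_val_eq v
  map_comp {m n p} f g := by
    ext v
    induction f using Quotient.inductionOn with | h f => ?_
    induction g using Quotient.inductionOn with | h g => ?_
    exact Lift.cast_toFun_eq g (intCast_val_eq _).symm

end LambdaR

/-- The category `ΔR`: the source of the discrete fibration over `ΛR^opp` given by `V` via the
Grothendieck construction. Its objects are pairs of a wheel `[n]` and a vertex `v` of `[n]`,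
and a morphism from `([n], v)` to `([m], w)` is a morphism `f : [m] → [n]` in `ΛR` with
`f w = v`. -/
abbrev DeltaR : Type := LambdaR.vertices.Elementsᵒᵖ

/-- The discrete fibration `j̃ : ΔR → ΛR^opp`, `([n], v) ↦ [n]`. -/
abbrev jTilde : DeltaR ⥤ LambdaRᵒᵖ := (CategoryOfElements.π LambdaR.vertices).op

/-! ### Cohomology of small categories -/

/-- `Ext` groups exist in `Fun(C, ℤ)` (this only fixes the universe in which they are formed). -/
instance hasExtFunctor (C : Type) [SmallCategory C] : HasExt.{1} (C ⥤ ModuleCat.{0} ℤ) :=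
  HasExt.standard _

/-- The cohomology `H^i(C, M) = R^i lim_C M = Ext^i(ℤ, M)` of a small category `C` with coefficients
in `M ∈ Fun(C, ℤ)`, where `ℤ` is the constant functor and `Ext` is taken in `Fun(C, ℤ)`. -/
noncomputable abbrev CatCohomology {C : Type} [SmallCategory C]
    (M : C ⥤ ModuleCat.{0} ℤ) (i : ℕ) : Type 1 :=
  Abelian.Ext.{1} ((Functor.const C).obj (ModuleCat.of ℤ ℤ)) M i

/-- The natural map `H^i(D, M) → H^i(C, F^* M)` of a functor `F : C ⥤ D`: it is induced by the exact
functor `F^*`, which sends the constant functor `ℤ` to the constant functor `ℤ`. -/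
noncomputable def CatCohomology.pullback {C D : Type} [SmallCategory C] [SmallCategory D]
    (F : C ⥤ D) (M : D ⥤ ModuleCat.{0} ℤ) (i : ℕ) :
    CatCohomology M i →+ CatCohomology (F ⋙ M) i :=
  ((Functor.whiskeringLeft C D (ModuleCat.{0} ℤ)).obj F).mapExtAddHom
    ((Functor.const D).obj (ModuleCat.of ℤ ℤ)) M i

/-! ### Profinite completeness -/

/-- An abelian group `A` is profinitely complete if the natural map `A → lim A / nA` is bijective,
the limit being over the integers `n ≥ 1` ordered by divisibility: any system of classes
`x n mod nA`, compatible with the projections `A / nA → A / mA` for `m ∣ n`, comes from a unique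
element of `A`. -/
def ProfinitelyCompleteGroup (A : Type*) [AddCommGroup A] : Prop :=
  ∀ x : ℕ+ → A, (∀ m n : ℕ+, m ∣ n → ∃ b : A, x n - x m = (m : ℕ) • b) →
    ∃! a : A, ∀ n : ℕ+, ∃ b : A, a - x n = (n : ℕ) • b

/-- A functor `M ∈ Fun(C, ℤ)` is profinitely complete if the natural map `M → lim M / nM` is an
isomorphism of functors, that is, if all its values are profinitely complete. -/
def ProfinitelyComplete {C : Type} [SmallCategory C] (M : C ⥤ ModuleCat.{0} ℤ) : Prop :=
  ∀ c : C, ProfinitelyCompleteGroup (M.obj c)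

/-! ### The category `[1/ℕ*]` -/

/-- The functor `ℤ(1)` on the category `[1/ℕ*]` with one object and the multiplicative monoid of
positive integers as endomorphisms: the value is `ℤ`, and `n` acts as multiplication by `n`. -/
noncomputable def tateTwist : SingleObj ℕ+ ⥤ ModuleCat.{0} ℤ where
  obj _ := ModuleCat.of ℤ ℤ
  map n := ModuleCat.ofHom (((n : ℕ+) : ℤ) • (LinearMap.id : ℤ →ₗ[ℤ] ℤ))
  map_id _ := by
    ext
    simp [SingleObj.id_as_one]
  map_comp f g := by
    ext
    have h : ∀ m n : ℕ+, (((m * n : ℕ+) : ℕ) : ℤ) = (m : ℤ) * (n : ℤ) := fun m n => by simp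
    simp only [SingleObj.comp_as_mul, ModuleCat.hom_ofHom, ModuleCat.hom_comp, LinearMap.smul_apply,
      LinearMap.comp_apply, LinearMap.id_apply, smul_eq_mul, mul_one]
    exact h g f

/-! ### Enough injectives in functor categories. -/

section FunctorCategory
open Limits

/-! Write M(1) for `degreeTwist degree M` and j_* for the right adjoint of restriction along
`jTilde`; its value at [n] is a product over the vertices of [n]. Since j_* is exact, H^*(ΛR^opp,
j_*G) = H^*(ΔR, G), and (i) says that the unit M → j_*j^*M is an isomorphism on cohomology.

The cellular cochains of a circle give a functorial exact sequence 0 → M → j_*j^*M → E(M) → M(1) → 0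
(`shortExact_totalIncrementComplex`), where E = `edgesObj` consists of periodic 1-cocycles on the
universal cover. A map of degree d wraps d times around its target, hence the twist. So (i) follows
once E(M) and M(1) have no cohomology.

For E(M) (`subsingleton_edges`): E commutes with j_*j^*, so the embedding of M in j_*j^*M reduces
the claim to ΔR, that is, to pointed wheels. A second coinduction, along coverings, reduces it to
pointed maps of degree one. There, truncating a cocycle at a moving point t contracts E(M) to 0, and
homotopic maps agree on cohomology (`map_homotopy`).

For M(1): profinite completeness presents M as the kernel of a surjection between products of
reductions M/j!, so M may be assumed to be killed by some N. On pointed wheels the covering [Nn] →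
[n] acts on M(1) through multiplication by N, that is, by 0. On cohomology, however, this action is
pullback along the dilation [n] ↦ [Nn], which is injective (`injective_pullback_dilation`). Hence
M(1) has no cohomology on ΔR. The four-term sequence for M(1) then identifies H^i(M(1)) with
H^(i-2)(M(1)(1)), and induction on i finishes (`subsingleton_degreeTwist_of_torsion`).

Part (ii) uses the same reduction to N-torsion coefficients. The central element N then acts on
cohomology both as the identity and as 0. -/

theorem functorModuleCat_ab5 (C : Type) [SmallCategory C] :
    AB5OfSize.{0, 0} (C ⥤ ModuleCat.{0} ℤ) where
  ofShape _ _ _ := inferInstance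

/-- This supplies the enough injectives behind every dimension shift below. The detour through Cᵒᵖᵒᵖ
makes the functors presheaves, for which a separator is available. -/
instance functorModuleCat_isGrothendieckAbelian (C : Type) [SmallCategory C] :
    IsGrothendieckAbelian.{0} (C ⥤ ModuleCat.{0} ℤ) :=
  have := functorModuleCat_ab5 Cᵒᵖᵒᵖ
  have : IsGrothendieckAbelian.{0} (Cᵒᵖᵒᵖ ⥤ ModuleCat.{0} ℤ) := { }
  IsGrothendieckAbelian.of_equivalence ((opOpEquivalence C).congrLeft (E := ModuleCat.{0} ℤ))

end FunctorCategory

/-! ### Ext groups under exact functors and adjunctions. -/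

section ExtLemmas
universe w w' w'' v v' v'' u u' u''
open Limits
variable {A : Type u} [Category.{v} A] [Abelian A] [HasExt.{w} A]
variable {B : Type u'} [Category.{v'} B] [Abelian B] [HasExt.{w'} B]
variable {E : Type u''} [Category.{v''} E] [Abelian E] [HasExt.{w''} E]

/-- In the presence of enough injectives, every class of positive degree is a product with the
class of an extension. -/
theorem Ext.exists_eq_comp_extClass [EnoughInjectives A] {X Y : A} {n : ℕ} (e : Ext X Y (n + 1)) :
    ∃ (I Z : A) (f : Y ⟶ I) (g : I ⟶ Z) (h : f ≫ g = 0)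
      (hS : (ShortComplex.mk f g h).ShortExact) (x : Ext X Z n), e = x.comp hS.extClass rfl := by
  obtain ⟨P⟩ := EnoughInjectives.presentation Y
  have hS : (ShortComplex.mk P.f (cokernel.π P.f) (cokernel.condition _)).ShortExact :=
    { exact := ShortComplex.exact_cokernel P.f }
  have := P.injective
  obtain ⟨x, hx⟩ := Ext.covariant_sequence_exact₁ X hS e (Ext.eq_zero_of_injective _) rfl
  exact ⟨_, _, _, _, _, hS, x, hx.symm⟩

theorem Ext.mapExactFunctor_comp_extClass (Φ : A ⥤ B)
    [Φ.Additive] [PreservesFiniteLimits Φ] [PreservesFiniteColimits Φ] {X Y I Z : A} {n : ℕ}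
    {f : Y ⟶ I} {g : I ⟶ Z} {h : f ≫ g = 0} (hS : (ShortComplex.mk f g h).ShortExact)
    (hS' : (ShortComplex.mk (Φ.map f) (Φ.map g)
      (by rw [← Φ.map_comp, h, Φ.map_zero])).ShortExact) (x : Ext X Z n) :
    (x.comp hS.extClass rfl).mapExactFunctor Φ = (x.mapExactFunctor Φ).comp hS'.extClass rfl :=
  (Ext.mapExactFunctor_comp _ _ _ _).trans
    (congrArg (fun z => Ext.comp _ z rfl) (Ext.mapExactFunctor_extClass _ _))

/-- Dimension shifting: a class of positive degree is a product with an extension class, and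
extension classes are natural with respect to the morphism of short exact sequences given by τ. -/
theorem Ext.mapExactFunctor_comp_natTrans [EnoughInjectives A] {Φ Ψ : A ⥤ B}
    [Φ.Additive] [PreservesFiniteLimits Φ] [PreservesFiniteColimits Φ]
    [Ψ.Additive] [PreservesFiniteLimits Ψ] [PreservesFiniteColimits Ψ] (τ : Φ ⟶ Ψ) {X Y : A} {n : ℕ}
    (e : Ext X Y n) :
    (e.mapExactFunctor Φ).comp (Ext.mk₀ (τ.app Y)) (add_zero n) =
      (Ext.mk₀ (τ.app X)).comp (e.mapExactFunctor Ψ) (zero_add n) := by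
  induction n generalizing Y with
  | zero =>
    obtain ⟨f, rfl⟩ := (Ext.mk₀_bijective X Y).2 e
    simp [Ext.mapExactFunctor_mk₀]
  | succ n ih =>
    obtain ⟨I, Z, f, g, h, hS, x, rfl⟩ := Ext.exists_eq_comp_extClass e
    have hΦ : (ShortComplex.mk (Φ.map f) (Φ.map g)
      (by rw [← Φ.map_comp, h, Φ.map_zero])).ShortExact := hS.map_of_exact Φ
    have hΨ : (ShortComplex.mk (Ψ.map f) (Ψ.map g)
      (by rw [← Ψ.map_comp, h, Ψ.map_zero])).ShortExact := hS.map_of_exact Ψ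
    have hnat : hΦ.extClass.comp (Ext.mk₀ (τ.app Y)) (add_zero 1) =
        (Ext.mk₀ (τ.app Z)).comp hΨ.extClass (zero_add 1) :=
      ShortComplex.ShortExact.extClass_naturality hΦ hΨ
        ⟨τ.app Y, τ.app I, τ.app Z, by simp, by simp⟩
    rw [Ext.mapExactFunctor_comp_extClass Φ hS hΦ, Ext.mapExactFunctor_comp_extClass Ψ hS hΨ,
      Ext.comp_assoc_of_third_deg_zero, hnat, ← Ext.comp_assoc_of_second_deg_zero, ih,
      Ext.comp_assoc _ _ _ (zero_add n) rfl (by omega)]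

theorem Ext.mapExactFunctor_mapExactFunctor [EnoughInjectives A] (Φ : A ⥤ B) (Ψ : B ⥤ E)
    [Φ.Additive] [PreservesFiniteLimits Φ] [PreservesFiniteColimits Φ]
    [Ψ.Additive] [PreservesFiniteLimits Ψ] [PreservesFiniteColimits Ψ] {X Y : A} {n : ℕ}
    (e : Ext X Y n) :
    (e.mapExactFunctor Φ).mapExactFunctor Ψ = e.mapExactFunctor (Φ ⋙ Ψ) := by
  induction n generalizing Y with
  | zero =>
    obtain ⟨f, rfl⟩ := (Ext.mk₀_bijective X Y).2 e
    simp only [Ext.mapExactFunctor_mk₀]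
    rfl
  | succ n ih =>
    obtain ⟨I, Z, f, g, h, hS, x, rfl⟩ := Ext.exists_eq_comp_extClass e
    have hΦ : (ShortComplex.mk (Φ.map f) (Φ.map g)
      (by rw [← Φ.map_comp, h, Φ.map_zero])).ShortExact := hS.map_of_exact Φ
    rw [Ext.mapExactFunctor_comp_extClass Φ hS hΦ,
      Ext.mapExactFunctor_comp_extClass Ψ hΦ (hΦ.map_of_exact Ψ), ih]
    exact (Ext.mapExactFunctor_comp_extClass (Φ ⋙ Ψ) hS (hS.map_of_exact (Φ ⋙ Ψ)) x).symm

theorem Ext.mapExactFunctor_id [EnoughInjectives A] {X Y : A} {n : ℕ} (e : Ext X Y n) :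
    e.mapExactFunctor (𝟭 A) = e := by
  induction n generalizing Y with
  | zero =>
    obtain ⟨f, rfl⟩ := (Ext.mk₀_bijective X Y).2 e
    simp only [Ext.mapExactFunctor_mk₀]
    rfl
  | succ n ih =>
    obtain ⟨I, Z, f, g, h, hS, x, rfl⟩ := Ext.exists_eq_comp_extClass e
    rw [Ext.mapExactFunctor_comp, Ext.mapExactFunctor_extClass, ih]
    rfl

/-- Exact adjoint functors are adjoint on `Ext` groups. -/
theorem Ext.bijective_mapExactFunctor_comp_counit [EnoughInjectives A] [EnoughInjectives B]
    {Φ : A ⥤ B} {Ψ : B ⥤ A} (adj : Φ ⊣ Ψ)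
    [Φ.Additive] [PreservesFiniteLimits Φ] [PreservesFiniteColimits Φ]
    [Ψ.Additive] [PreservesFiniteLimits Ψ] [PreservesFiniteColimits Ψ] (X : A) (Y : B) (n : ℕ) :
    Function.Bijective (fun e : Ext X (Ψ.obj Y) n =>
      (e.mapExactFunctor Φ).comp (Ext.mk₀ (adj.counit.app Y)) (add_zero n)) := by
  refine Function.bijective_iff_has_inverse.2
    ⟨fun e => (Ext.mk₀ (adj.unit.app X)).comp (e.mapExactFunctor Ψ) (zero_add n), ?_, ?_⟩
  · intro e
    dsimp only
    rw [Ext.mapExactFunctor_comp, Ext.mapExactFunctor_mk₀, Ext.mapExactFunctor_mapExactFunctor]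
    -- As for Hom: naturality of the unit moves it past e, and a triangle identity cancels it
    -- against the counit.
    refine (Ext.comp_assoc _ _ _ (zero_add n) (add_zero n) (by omega)).symm.trans ?_
    refine (congrArg (fun z => Ext.comp z _ _)
      (Ext.mapExactFunctor_comp_natTrans adj.unit e).symm).trans ?_
    refine (Ext.comp_assoc_of_third_deg_zero _ _ _ _).trans ?_
    rw [Ext.mk₀_comp_mk₀, adj.right_triangle_components]
    exact (Ext.comp_mk₀_id _).trans (Ext.mapExactFunctor_id e)
  · intro e
    dsimp only
    rw [Ext.mapExactFunctor_comp, Ext.mapExactFunctor_mk₀, Ext.mapExactFunctor_mapExactFunctor]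
    refine (Ext.comp_assoc _ _ _ (zero_add n) (add_zero n) (by omega)).trans ?_
    refine (congrArg (fun z => Ext.comp _ z _)
      (Ext.mapExactFunctor_comp_natTrans adj.counit e)).trans ?_
    refine (Ext.mk₀_comp_mk₀_assoc _ _ _).trans ?_
    rw [adj.left_triangle_components]
    exact (Ext.mk₀_id_comp _).trans (Ext.mapExactFunctor_id e)

end ExtLemmas

/-- The category of abelian groups. -/
abbrev ModZ : Type 1 := ModuleCat.{0} ℤ

/-! ### Pointwise exactness in Fun(C, ℤ). -/

section Pointwise
open Limits
variable {C : Type} [SmallCategory C]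

/-- The morphism of abelian groups given by an additive map. -/
def ModZ.homMk {A B : ModZ} (f : A → B) (h : ∀ x y, f (x + y) = f x + f y) : A ⟶ B :=
  ModuleCat.ofHom
    { toFun := f
      map_add' := h
      map_smul' := fun n x => map_intCast_smul (AddMonoidHom.mk' f h) ℤ ℤ n x }

theorem ModZ.hom_ext {A B : ModZ} {f g : A ⟶ B} (h : ∀ x, f x = g x) : f = g :=
  ConcreteCategory.hom_ext _ _ h

theorem ModZ.natTrans_ext {M N : C ⥤ ModZ} {φ ψ : M ⟶ N} (h : ∀ c x, φ.app c x = ψ.app c x) :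
    φ = ψ :=
  NatTrans.ext (funext fun c => ModZ.hom_ext (h c))

theorem ModZ.naturality_apply {M N : C ⥤ ModZ} (φ : M ⟶ N) {c d : C} (f : c ⟶ d) (x : M.obj c) :
    φ.app d (M.map f x) = N.map f (φ.app c x) :=
  congrArg (fun g : M.obj c ⟶ N.obj d => g x) (φ.naturality f)

theorem ModZ.map_comp_apply (M : C ⥤ ModZ) {c d e : C} (f : c ⟶ d) (g : d ⟶ e) (x : M.obj c) :
    M.map (f ≫ g) x = M.map g (M.map f x) :=
  congrArg (fun h : M.obj c ⟶ M.obj e => h x) (M.map_comp f g)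

theorem ModZ.map_id_apply (M : C ⥤ ModZ) {c : C} (x : M.obj c) : M.map (𝟙 c) x = x :=
  congrArg (fun h : M.obj c ⟶ M.obj c => h x) (M.map_id c)

theorem CategoryTheory.ShortComplex.exact_of_evaluation {S : ShortComplex (C ⥤ ModZ)}
    (h : ∀ c, (S.map ((evaluation C ModZ).obj c)).Exact) : S.Exact := by
  rw [ShortComplex.exact_iff_isZero_homology, Functor.isZero_iff]
  intro c
  exact ((ShortComplex.exact_iff_isZero_homology _).1 (h c)).of_iso
    (S.mapHomologyIso ((evaluation C ModZ).obj c)).symm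

theorem CategoryTheory.ShortComplex.shortExact_of_pointwise {S : ShortComplex (C ⥤ ModZ)}
    (inj : ∀ c, Function.Injective (S.f.app c))
    (ex : ∀ c (x : S.X₂.obj c), S.g.app c x = 0 → ∃ y, S.f.app c y = x)
    (surj : ∀ c, Function.Surjective (S.g.app c)) : S.ShortExact where
  exact := ShortComplex.exact_of_evaluation fun c =>
    (ShortComplex.moduleCat_exact_iff _).2 fun x hx => ex c x hx
  mono_f := (NatTrans.mono_iff_mono_app _).2 fun c => (ModuleCat.mono_iff_injective _).2 (inj c)
  epi_g := (NatTrans.epi_iff_epi_app _).2 fun c => (ModuleCat.epi_iff_surjective _).2 (surj c)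

theorem CategoryTheory.ShortComplex.ShortExact.injective_app
    {S : ShortComplex (C ⥤ ModZ)} (hS : S.ShortExact) (c : C) : Function.Injective (S.f.app c) :=
  (hS.map_of_exact ((evaluation C ModZ).obj c)).moduleCat_injective_f

theorem CategoryTheory.ShortComplex.ShortExact.surjective_app
    {S : ShortComplex (C ⥤ ModZ)} (hS : S.ShortExact) (c : C) : Function.Surjective (S.g.app c) :=
  (hS.map_of_exact ((evaluation C ModZ).obj c)).moduleCat_surjective_g

theorem CategoryTheory.ShortComplex.ShortExact.exact_app
    {S : ShortComplex (C ⥤ ModZ)} (hS : S.ShortExact) (c : C) (x : S.X₂.obj c)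
    (hx : S.g.app c x = 0) : ∃ y, S.f.app c y = x :=
  (ShortComplex.moduleCat_exact_iff _).1 (hS.map_of_exact ((evaluation C ModZ).obj c)).exact x hx

theorem ModZ.mono_of_injective {M N : C ⥤ ModZ} (φ : M ⟶ N)
    (h : ∀ c, Function.Injective (φ.app c)) : Mono φ :=
  (NatTrans.mono_iff_mono_app _).2 fun c => (ModuleCat.mono_iff_injective _).2 (h c)

/-- A monomorphism and its cokernel. -/
noncomputable abbrev cokernelShortComplex {M N : C ⥤ ModZ} (φ : M ⟶ N) :
    ShortComplex (C ⥤ ModZ) :=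
  ShortComplex.mk φ (cokernel.π φ) (cokernel.condition φ)

theorem shortExact_cokernelShortComplex {M N : C ⥤ ModZ} (φ : M ⟶ N) [Mono φ] :
    (cokernelShortComplex φ).ShortExact where
  exact := ShortComplex.exact_cokernel φ

/-- A functor that preserves pointwise short exact sequences is exact. -/
theorem preservesFiniteLimits_and_colimits_of_shortExact {D : Type} [SmallCategory D]
    (Φ : (C ⥤ ModZ) ⥤ (D ⥤ ModZ)) [Φ.Additive]
    (h : ∀ S : ShortComplex (C ⥤ ModZ), S.ShortExact → (S.map Φ).ShortExact) :
    PreservesFiniteLimits Φ ∧ PreservesFiniteColimits Φ :=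
  (Φ.exact_tfae.out 0 3).1 h

end Pointwise

/-! ### Long exact sequences and pullback for cohomology of categories. -/

namespace CatCohomology
variable {C : Type} [SmallCategory C]

/-- The map on cohomology induced by a map of coefficients. -/
noncomputable def map {M N : C ⥤ ModZ} (φ : M ⟶ N) (i : ℕ) :
    CatCohomology M i →+ CatCohomology N i where
  toFun e := e.comp (Ext.mk₀ φ) (add_zero i)
  map_zero' := by simp
  map_add' _ _ := Ext.add_comp _ _ _ _

@[simp] theorem map_id (M : C ⥤ ModZ) {i : ℕ} (e : CatCohomology M i) : map (𝟙 M) i e = e :=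
  Ext.comp_mk₀_id e

theorem map_comp {M N P : C ⥤ ModZ} (φ : M ⟶ N) (ψ : N ⟶ P) {i : ℕ} (e : CatCohomology M i) :
    map (φ ≫ ψ) i e = map ψ i (map φ i e) := by
  change e.comp _ (add_zero i) = (e.comp _ (add_zero i)).comp _ (add_zero i)
  rw [Ext.comp_assoc_of_third_deg_zero, Ext.mk₀_comp_mk₀]

theorem map_zero (M N : C ⥤ ModZ) {i : ℕ} (e : CatCohomology M i) :
    map (0 : M ⟶ N) i e = 0 := by
  change e.comp _ (add_zero i) = 0
  rw [Ext.mk₀_zero, Ext.comp_zero]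

theorem map_bijective {M N : C ⥤ ModZ} (φ : M ≅ N) (i : ℕ) :
    Function.Bijective (map φ.hom i) :=
  Function.bijective_iff_has_inverse.2 ⟨map φ.inv i, fun e => by simp [← map_comp],
    fun e => by simp [← map_comp]⟩

theorem subsingleton_of_iso {M N : C ⥤ ModZ} (φ : M ≅ N) {i : ℕ}
    (h : Subsingleton (CatCohomology N i)) : Subsingleton (CatCohomology M i) :=
  (map_bijective φ i).1.subsingleton

/-- The connecting homomorphism of a short exact sequence of coefficients. -/
noncomputable def δ {S : ShortComplex (C ⥤ ModZ)} (hS : S.ShortExact) (i : ℕ) :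
    CatCohomology S.X₃ i →+ CatCohomology S.X₁ (i + 1) where
  toFun e := e.comp hS.extClass rfl
  map_zero' := by simp
  map_add' _ _ := Ext.add_comp _ _ _ _

section Sequence
variable {S : ShortComplex (C ⥤ ModZ)} {i : ℕ}

theorem exists_δ_eq (hS : S.ShortExact) (e : CatCohomology S.X₁ (i + 1))
    (he : map S.f (i + 1) e = 0) :
    ∃ q, δ hS i q = e :=
  Ext.covariant_sequence_exact₁ _ hS e he rfl

theorem exists_map_f_eq (hS : S.ShortExact) (e : CatCohomology S.X₂ i) (he : map S.g i e = 0) :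
    ∃ q, map S.f i q = e :=
  Ext.covariant_sequence_exact₂ _ hS e he

theorem exists_map_g_eq (hS : S.ShortExact) (e : CatCohomology S.X₃ i) (he : δ hS i e = 0) :
    ∃ q, map S.g i q = e :=
  Ext.covariant_sequence_exact₃ _ hS e rfl he

theorem δ_map_g (hS : S.ShortExact) (e : CatCohomology S.X₂ i) : δ hS i (map S.g i e) = 0 := by
  change (e.comp _ (add_zero i)).comp _ rfl = 0
  rw [Ext.comp_assoc_of_second_deg_zero, hS.comp_extClass, Ext.comp_zero]

theorem map_f_zero_injective (hS : S.ShortExact) : Function.Injective (map S.f 0) := by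
  rw [injective_iff_map_eq_zero]
  intro e he
  have := hS.mono_f
  obtain ⟨φ, rfl⟩ := (Ext.mk₀_bijective _ _).2 e
  have he' : (Ext.mk₀ φ).comp (Ext.mk₀ S.f) (add_zero 0) = 0 := he
  rw [Ext.mk₀_comp_mk₀, Ext.mk₀_eq_zero_iff] at he'
  rw [Ext.mk₀_eq_zero_iff]
  exact (cancel_mono S.f).1 (by rw [he', Limits.zero_comp])

theorem subsingleton_left_zero (hS : S.ShortExact) (h : Subsingleton (CatCohomology S.X₂ 0)) :
    Subsingleton (CatCohomology S.X₁ 0) :=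
  (map_f_zero_injective hS).subsingleton

theorem subsingleton_left_succ (hS : S.ShortExact) (h₃ : Subsingleton (CatCohomology S.X₃ i))
    (h₂ : Subsingleton (CatCohomology S.X₂ (i + 1))) :
    Subsingleton (CatCohomology S.X₁ (i + 1)) :=
  subsingleton_of_forall_eq 0 fun e => by
    obtain ⟨q, rfl⟩ := exists_δ_eq hS e (Subsingleton.elim _ _)
    rw [Subsingleton.elim q 0, _root_.map_zero]

theorem subsingleton_right (hS : S.ShortExact) (h₂ : Subsingleton (CatCohomology S.X₂ i))
    (h₁ : Subsingleton (CatCohomology S.X₁ (i + 1))) :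
    Subsingleton (CatCohomology S.X₃ i) :=
  subsingleton_of_forall_eq 0 fun e => by
    obtain ⟨q, rfl⟩ := exists_map_g_eq hS e (Subsingleton.elim _ _)
    rw [Subsingleton.elim q 0, _root_.map_zero]

theorem map_f_bijective (hS : S.ShortExact) (h : ∀ j, Subsingleton (CatCohomology S.X₃ j)) (i : ℕ) :
    Function.Bijective (map S.f i) := by
  refine ⟨?_, fun e => exists_map_f_eq hS e ((h i).elim _ _)⟩
  cases i with
  | zero => exact map_f_zero_injective hS
  | succ i =>
    rw [injective_iff_map_eq_zero]
    intro e he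
    obtain ⟨q, rfl⟩ := exists_δ_eq hS e he
    rw [(h i).elim q 0, _root_.map_zero]

end Sequence

theorem δ_naturality {S T : ShortComplex (C ⥤ ModZ)} (hS : S.ShortExact) (hT : T.ShortExact)
    (τ : S ⟶ T) {i : ℕ} (e : CatCohomology S.X₃ i) :
    map τ.τ₁ (i + 1) (δ hS i e) = δ hT i (map τ.τ₃ i e) := by
  change (e.comp _ rfl).comp _ (add_zero (i + 1)) = (e.comp _ (add_zero i)).comp _ rfl
  rw [Ext.comp_assoc_of_third_deg_zero, Ext.comp_assoc_of_second_deg_zero,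
    ShortComplex.ShortExact.extClass_naturality hS hT τ]

section Pullback
variable {D E : Type} [SmallCategory D] [SmallCategory E]

theorem pullback_map (u : C ⥤ D) {M N : D ⥤ ModZ} (φ : M ⟶ N) {i : ℕ} (e : CatCohomology M i) :
    pullback u N i (map φ i e) = map (u.whiskerLeft φ) i (pullback u M i e) :=
  (Ext.mapExactFunctor_comp _ _ _ (add_zero i)).trans
    (congrArg (fun z => Ext.comp _ z (add_zero i)) (Ext.mapExactFunctor_mk₀ _ _))

/-- The restriction of a short exact sequence of coefficients. -/
abbrev restrict (u : C ⥤ D) (S : ShortComplex (D ⥤ ModZ)) : ShortComplex (C ⥤ ModZ) :=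
  ShortComplex.mk (u.whiskerLeft S.f) (u.whiskerLeft S.g)
    (by rw [← Functor.whiskerLeft_comp, S.zero]; rfl)

theorem shortExact_restrict (u : C ⥤ D) {S : ShortComplex (D ⥤ ModZ)} (hS : S.ShortExact) :
    (restrict u S).ShortExact :=
  hS.map_of_exact ((Functor.whiskeringLeft C D ModZ).obj u)

theorem pullback_δ (u : C ⥤ D) {S : ShortComplex (D ⥤ ModZ)} (hS : S.ShortExact) {i : ℕ}
    (e : CatCohomology S.X₃ i) :
    pullback u S.X₁ (i + 1) (δ hS i e) =
      δ (shortExact_restrict u hS) i (pullback u S.X₃ i e) :=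
  (Ext.mapExactFunctor_comp _ _ _ _).trans
    (congrArg (fun z => Ext.comp _ z rfl) (Ext.mapExactFunctor_extClass _ hS))

/-- θ acts as the identity on the constant functor ℤ, so naturality of Ext in the functor leaves
only its effect on the coefficients. This is the source of all homotopy arguments below: it compares
pullbacks along different functors. -/
theorem map_whiskerRight_pullback {u v : C ⥤ D} (θ : u ⟶ v) (M : D ⥤ ModZ) {i : ℕ}
    (e : CatCohomology M i) :
    map (Functor.whiskerRight θ M) i (pullback u M i e) = pullback v M i e := by
  refine (Ext.mapExactFunctor_comp_natTrans
    ((Functor.whiskeringLeft C D ModZ).map θ) e).trans ?_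
  have : ((Functor.whiskeringLeft C D ModZ).map θ).app
      ((Functor.const D).obj (ModuleCat.of ℤ ℤ)) = 𝟙 _ := by
    ext; rfl
  rw [this]
  exact Ext.mk₀_id_comp _

theorem pullback_pullback (u : C ⥤ D) (v : D ⥤ E) (M : E ⥤ ModZ) {i : ℕ}
    (e : CatCohomology M i) :
    pullback u (v ⋙ M) i (pullback v M i e) = pullback (u ⋙ v) M i e :=
  Ext.mapExactFunctor_mapExactFunctor ((Functor.whiskeringLeft D E ModZ).obj v)
    ((Functor.whiskeringLeft C D ModZ).obj u) e

theorem pullback_id (M : C ⥤ ModZ) {i : ℕ} (e : CatCohomology M i) :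
    pullback (𝟭 C) M i e = e :=
  Ext.mapExactFunctor_id e

theorem pullback_injective_of_isEquivalence (u : C ⥤ D) [u.IsEquivalence] (M : D ⥤ ModZ) (i : ℕ) :
    Function.Injective (pullback u M i) := by
  rw [injective_iff_map_eq_zero]
  intro e he
  have h := map_whiskerRight_pullback u.asEquivalence.counitIso.hom M e
  rw [← pullback_id M e]
  refine h.symm.trans ?_
  refine (congrArg _ (pullback_pullback u.inv u M e).symm).trans ?_
  rw [he, _root_.map_zero]
  exact _root_.map_zero _

/-- Cohomology with coefficients in the image of an exact right adjoint of a restriction functor. -/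
theorem bijective_pullback_counit (u : C ⥤ D) {Ψ : (C ⥤ ModZ) ⥤ (D ⥤ ModZ)}
    (adj : (Functor.whiskeringLeft C D ModZ).obj u ⊣ Ψ) [Ψ.Additive]
    [Limits.PreservesFiniteLimits Ψ] [Limits.PreservesFiniteColimits Ψ] (G : C ⥤ ModZ) (i : ℕ) :
    Function.Bijective (fun e : CatCohomology (Ψ.obj G) i =>
      map (M := u ⋙ Ψ.obj G) (adj.counit.app G) i (pullback u (Ψ.obj G) i e)) :=
  Ext.bijective_mapExactFunctor_comp_counit adj _ G i

end Pullback

end CatCohomology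

/-! ### Cohomology of products. -/

section Products
open Limits
variable {C J : Type} [SmallCategory C]

/-- The pointwise product of a family of functors. -/
def pointwisePi (Y : J → C ⥤ ModZ) : C ⥤ ModZ where
  obj c := ModuleCat.of ℤ (∀ j, (Y j).obj c)
  map f := ModZ.homMk (fun x j => (Y j).map f (x j)) fun _ _ => funext fun _ => map_add _ _ _
  map_id _ := ModZ.hom_ext fun _ => funext fun j => ModZ.map_id_apply (Y j) _
  map_comp f g := ModZ.hom_ext fun _ => funext fun j => ModZ.map_comp_apply (Y j) f g _

/-- The projections of `pointwisePi`. -/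
def pointwisePi.proj (Y : J → C ⥤ ModZ) (j : J) : pointwisePi Y ⟶ Y j where
  app _ := ModZ.homMk (fun x => x j) fun _ _ => rfl
  naturality _ _ _ := rfl

/-- The map to `pointwisePi` with given components. -/
def pointwisePi.lift {X : C ⥤ ModZ} {Y : J → C ⥤ ModZ} (φ : ∀ j, X ⟶ Y j) :
    X ⟶ pointwisePi Y where
  app c := ModZ.homMk (fun x j => (φ j).app c x) fun _ _ => funext fun _ => map_add _ _ _
  naturality _ _ f := ModZ.hom_ext fun x => funext fun j => ModZ.naturality_apply (φ j) f x

theorem pointwisePi.lift_proj {X : C ⥤ ModZ} {Y : J → C ⥤ ModZ} (φ : ∀ j, X ⟶ Y j) (j : J) :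
    pointwisePi.lift φ ≫ pointwisePi.proj Y j = φ j := rfl

theorem pointwisePi.hom_ext {X : C ⥤ ModZ} {Y : J → C ⥤ ModZ} {φ ψ : X ⟶ pointwisePi Y}
    (h : ∀ j, φ ≫ pointwisePi.proj Y j = ψ ≫ pointwisePi.proj Y j) : φ = ψ :=
  ModZ.natTrans_ext fun c x => funext fun j => congrArg (fun χ : X ⟶ Y j => χ.app c x) (h j)

/-- The map of products with given components. -/
def pointwisePi.map {X Y : J → C ⥤ ModZ} (φ : ∀ j, X j ⟶ Y j) : pointwisePi X ⟶ pointwisePi Y :=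
  pointwisePi.lift fun j => pointwisePi.proj X j ≫ φ j

instance (Y : J → C ⥤ ModZ) [∀ j, Injective (Y j)] : Injective (pointwisePi Y) where
  factors g f _ := ⟨pointwisePi.lift fun j => Injective.factorThru (g ≫ pointwisePi.proj Y j) f,
    pointwisePi.hom_ext fun j => by
      rw [Category.assoc, pointwisePi.lift_proj, Injective.comp_factorThru]⟩

theorem pointwisePi.shortExact (S : J → ShortComplex (C ⥤ ModZ)) (hS : ∀ j, (S j).ShortExact) :
    (ShortComplex.mk (pointwisePi.map fun j => (S j).f) (pointwisePi.map fun j => (S j).g)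
      (pointwisePi.hom_ext fun j =>
        (congrArg (fun χ => pointwisePi.proj (fun j => (S j).X₁) j ≫ χ) (S j).zero).trans
          (by rw [comp_zero, zero_comp]))).ShortExact :=
  ShortComplex.shortExact_of_pointwise
    (fun c x y h => funext fun j => (hS j).injective_app c (congrFun h j))
    (fun c x hx => by
      choose y hy using fun j => (hS j).exact_app c (x j) (congrFun hx j)
      exact ⟨y, funext hy⟩)
    (fun c x => by
      choose y hy using fun j => (hS j).surjective_app c (x j)
      exact ⟨y, funext hy⟩)

namespace CatCohomology

theorem subsingleton_of_injective (I : C ⥤ ModZ) [Injective I] (i : ℕ) :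
    Subsingleton (CatCohomology I (i + 1)) :=
  subsingleton_of_forall_eq 0 fun e => Ext.eq_zero_of_injective e

/-- Products of functors are exact and products of injectives are injective, so dimension shifting
applies factor by factor. -/
theorem subsingleton_pointwisePi (Y : J → C ⥤ ModZ) (i : ℕ)
    (h : ∀ j, Subsingleton (CatCohomology (Y j) i)) :
    Subsingleton (CatCohomology (pointwisePi Y) i) := by
  induction i generalizing Y with
  | zero =>
    refine subsingleton_of_forall_eq 0 fun e => ?_
    obtain ⟨φ, rfl⟩ := (Ext.mk₀_bijective _ _).2 e
    rw [Ext.mk₀_eq_zero_iff]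
    refine pointwisePi.hom_ext fun j => ?_
    rw [zero_comp]
    exact (Ext.mk₀_bijective _ _).1 ((h j).elim _ _)
  | succ i ih =>
    let S : J → ShortComplex (C ⥤ ModZ) := fun j => cokernelShortComplex (Injective.ι (Y j))
    have hS : ∀ j, (S j).ShortExact := fun j => shortExact_cokernelShortComplex _
    have hinj : ∀ j, Injective (S j).X₂ := fun j => inferInstanceAs (Injective (Injective.under _))
    have hpi := pointwisePi.shortExact S hS
    have hI : Subsingleton (CatCohomology (pointwisePi fun j => (S j).X₂) (i + 1)) :=
      subsingleton_of_injective _ _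
    cases i with
    -- Degree one is separate because H^0 of the quotients need not vanish. Instead, vanishing of
    -- each H^1 lifts each component of φ, and the lifts assemble into a lift to the product.
    | zero =>
      refine subsingleton_of_forall_eq 0 fun e => ?_
      obtain ⟨q, rfl⟩ := exists_δ_eq hpi e (hI.elim _ _)
      obtain ⟨φ, rfl⟩ := (Ext.mk₀_bijective _ _).2 q
      choose t ht using fun j => exists_map_g_eq (hS j)
        (Ext.mk₀ (φ ≫ pointwisePi.proj (fun j => (S j).X₃) j)) ((h j).elim _ _)
      choose ψ hψ using fun j => (Ext.mk₀_bijective _ _).2 (t j)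
      have : Ext.mk₀ φ = map (pointwisePi.map fun j => (S j).g) 0
          (Ext.mk₀ (pointwisePi.lift ψ)) := by
        refine Eq.trans ?_ (Ext.mk₀_comp_mk₀ _ _).symm
        congr 1
        refine pointwisePi.hom_ext fun j => ?_
        apply (Ext.mk₀_bijective _ _).1
        rw [← ht j, ← hψ j]
        exact Ext.mk₀_comp_mk₀ _ _
      rw [this]
      exact δ_map_g hpi _
    | succ i =>
      exact subsingleton_left_succ hpi (ih _ fun j => subsingleton_right (hS j)
        (subsingleton_of_injective (S j).X₂ i) (h j)) hI

end CatCohomology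
end Products

/-! ### Pullback along constant functors. -/

section Point
open Limits

theorem ModZ.hom_ext_int {A : ModZ} {f g : ModuleCat.of ℤ ℤ ⟶ A} (h : f (1 : ℤ) = g (1 : ℤ)) :
    f = g :=
  ModuleCat.hom_ext (LinearMap.ext_ring h)

instance projective_const_point :
    Projective ((Functor.const (Discrete PUnit.{1})).obj (ModuleCat.of ℤ ℤ)) where
  factors {E X} f e he := by
    have hsurj := (ModuleCat.epi_iff_surjective _).1
      ((NatTrans.epi_iff_epi_app e).1 he ⟨⟨⟩⟩)
    obtain ⟨y, hy⟩ := hsurj (f.app ⟨⟨⟩⟩ (1 : ℤ))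
    refine ⟨{ app := fun _ => ModZ.homMk (fun n : ℤ => n • y) fun _ _ => add_zsmul _ _ _
              naturality := ?_ }, ?_⟩
    · rintro ⟨⟨⟩⟩ ⟨⟨⟩⟩ g
      obtain rfl : g = 𝟙 _ := Subsingleton.elim _ _
      simp
    · refine NatTrans.ext (funext fun ⟨⟨⟩⟩ => ModZ.hom_ext_int ?_)
      exact (congrArg (e.app ⟨⟨⟩⟩) (one_zsmul y)).trans hy

/-- A constant functor factors through the one-point category, where ℤ is projective and higher
cohomology vanishes. -/
theorem CatCohomology.pullback_const_eq_zero {C D : Type} [SmallCategory C] [SmallCategory D]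
    (d : D) (M : D ⥤ ModZ) {i : ℕ} (e : CatCohomology M (i + 1)) :
    pullback ((Functor.const C).obj d) M (i + 1) e = 0 := by
  have h := pullback_pullback ((Functor.const C).obj (⟨⟨⟩⟩ : Discrete PUnit.{1}))
    ((Functor.const (Discrete PUnit.{1})).obj d) M e
  refine h.symm.trans ?_
  have h0 : pullback ((Functor.const (Discrete PUnit.{1})).obj d) M (i + 1) e = 0 :=
    Ext.eq_zero_of_projective _
  rw [h0]
  exact _root_.map_zero _

end Point

/-! ### Coinduction along a category of elements. -/

namespace CategoryTheory.Functor.Elements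
open Opposite
variable {C : Type} [SmallCategory C] (S : C ⥤ Type)

/-- The vertex and the source of the morphism change together; this packages the dependent
rewriting, leaving only underlying morphisms to compare. -/
theorem map_apply_eq {S : C ⥤ Type} (G : S.Elementsᵒᵖ ⥤ ModZ) {c : C}
    (y : ∀ v : S.obj c, G.obj (op ⟨c, v⟩))
    {v v' : S.obj c} {x : S.Elementsᵒᵖ} (g : (op ⟨c, v⟩ : S.Elementsᵒᵖ) ⟶ x)
    (g' : (op ⟨c, v'⟩ : S.Elementsᵒᵖ) ⟶ x)
    (hv : v = v') (hg : g.unop.val = g'.unop.val) : G.map g (y v) = G.map g' (y v') := by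
  subst hv
  obtain rfl : g = g' := Quiver.Hom.unop_inj (Subtype.ext hg)
  rfl

/-- The canonical morphism in the category of elements above `f`. -/
def homMap {S : C ⥤ Type} {c d : C} (f : c ⟶ d) (v : S.obj c) :
    S.elementsMk c v ⟶ S.elementsMk d (S.map f v) := ⟨f, rfl⟩

/-- The right adjoint of restriction along `S.Elementsᵒᵖ ⥤ Cᵒᵖ`, on objects. -/
def coindObj (G : S.Elementsᵒᵖ ⥤ ModZ) : Cᵒᵖ ⥤ ModZ where
  obj c := ModuleCat.of ℤ (∀ v : S.obj c.unop, G.obj (op ⟨c.unop, v⟩))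
  map {c d} f := ModZ.homMk
    (fun (y : ∀ v : S.obj c.unop, G.obj (op ⟨c.unop, v⟩)) (v : S.obj d.unop) =>
      G.map (homMap f.unop v).op (y (S.map f.unop v)))
    fun _ _ => funext fun _ => _root_.map_add _ _ _
  map_id c := ModZ.hom_ext fun y => funext fun v =>
    (map_apply_eq G y (homMap (𝟙 c.unop) v).op (𝟙 _) (by simp) rfl).trans (ModZ.map_id_apply G _)
  map_comp {c d e} f g := ModZ.hom_ext fun y => funext fun v =>
    (map_apply_eq G y (homMap (g.unop ≫ f.unop) v).op
      ((homMap f.unop (S.map g.unop v)).op ≫ (homMap g.unop v).op)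
      (by simp) rfl).trans (ModZ.map_comp_apply G _ _ _)

/-- The right adjoint of restriction along the projection `S.Elementsᵒᵖ ⥤ Cᵒᵖ`. -/
def coind : (S.Elementsᵒᵖ ⥤ ModZ) ⥤ (Cᵒᵖ ⥤ ModZ) where
  obj G := coindObj S G
  map φ :=
    { app := fun c => ModZ.homMk (fun y v => φ.app (op ⟨c.unop, v⟩) (y v))
        fun _ _ => funext fun _ => _root_.map_add _ _ _
      naturality := fun c d f => ModZ.hom_ext fun y => funext fun v =>
        ModZ.naturality_apply φ _ _ }

instance : (coind S).Additive where
  map_add := rfl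

theorem coind_exact :
    Limits.PreservesFiniteLimits (coind S) ∧ Limits.PreservesFiniteColimits (coind S) :=
  preservesFiniteLimits_and_colimits_of_shortExact _ fun T hT =>
    ShortComplex.shortExact_of_pointwise
      (fun c x y h => funext fun v => hT.injective_app _ (congrFun h v))
      (fun c x hx => by
        choose y hy using fun v => hT.exact_app _ (x v) (congrFun hx v)
        exact ⟨y, funext hy⟩)
      (fun c x => by
        choose y hy using fun v => hT.surjective_app _ (x v)
        exact ⟨y, funext hy⟩)

instance : Limits.PreservesFiniteLimits (coind S) := (coind_exact S).1
instance : Limits.PreservesFiniteColimits (coind S) := (coind_exact S).2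

/-- The unit of the adjunction between restriction and `coind`. -/
def coindUnit (M : Cᵒᵖ ⥤ ModZ) : M ⟶ coindObj S ((CategoryOfElements.π S).op ⋙ M) where
  app _ := ModZ.homMk (fun x _ => x) fun _ _ => rfl
  naturality _ _ _ := rfl

/-- Restriction along the projection from the category of elements is left adjoint to `coind`. -/
def coindAdjunction :
    (Functor.whiskeringLeft _ _ ModZ).obj (CategoryOfElements.π S).op ⊣ coind S :=
  Adjunction.mkOfUnitCounit
    { unit := { app := coindUnit S, naturality := fun _ _ _ => rfl }
      left_triangle := rfl
      right_triangle := rfl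
      counit :=
        { naturality := fun _ _ _ => rfl
          app := fun G =>
            { app := fun x => ModZ.homMk
                (fun y : ∀ v : S.obj x.unop.1, G.obj (op ⟨x.unop.1, v⟩) => y x.unop.2)
                fun _ _ => rfl
              naturality := fun _ _ f => ModZ.hom_ext fun y =>
                map_apply_eq G y _ f f.unop.2 rfl } } }

/-- Pullback along the projection from the category of elements is an isomorphism if and only if
the unit of the adjunction induces one. -/
theorem bijective_pullback_of_bijective_unit (M : Cᵒᵖ ⥤ ModZ) (i : ℕ)
    (h : Function.Bijective (CatCohomology.map (coindUnit S M) i)) :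
    Function.Bijective (CatCohomology.pullback (CategoryOfElements.π S).op M i) := by
  have h2 := CatCohomology.bijective_pullback_counit (CategoryOfElements.π S).op
    (coindAdjunction S) ((CategoryOfElements.π S).op ⋙ M) i
  -- By the triangle identity, the unit followed by the adjunction bijection is pullback.
  refine (congrArg Function.Bijective (funext fun e => ?_)).mpr (h2.comp h)
  refine Eq.trans ?_ (congrArg (CatCohomology.map _ i)
    (CatCohomology.pullback_map _ (coindUnit S M) e).symm)
  refine Eq.trans ?_ (CatCohomology.map_comp _ _ _)
  exact (CatCohomology.map_id _ _).symm

theorem subsingleton_coind (G : S.Elementsᵒᵖ ⥤ ModZ) (i : ℕ)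
    (h : Subsingleton (CatCohomology G i)) : Subsingleton (CatCohomology (coindObj S G) i) := by
  have h' : Subsingleton (CatCohomology ((𝟭 _ : _ ⥤ S.Elementsᵒᵖ ⥤ ModZ).obj G) i) := h
  exact (CatCohomology.bijective_pullback_counit (CategoryOfElements.π S).op
    (coindAdjunction S) G i).1.subsingleton

end CategoryTheory.Functor.Elements

namespace CatCohomology
variable {C D : Type} [SmallCategory C] [SmallCategory D]

/-- The map between restrictions of a contravariant functor induced by a natural transformation. -/
abbrev opMap {u v : C ⥤ D} (θ : v ⟶ u) (G : Dᵒᵖ ⥤ ModZ) : u.op ⋙ G ⟶ v.op ⋙ G :=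
  Functor.whiskerRight (NatTrans.op θ) G

theorem map_opMap_pullback {u v : C ⥤ D} (θ : v ⟶ u) (G : Dᵒᵖ ⥤ ModZ) {i : ℕ}
    (e : CatCohomology G i) :
    map (opMap θ G) i (pullback u.op G i e) = pullback v.op G i e :=
  map_whiskerRight_pullback (NatTrans.op θ) G e

/-- The map from a contravariant functor to its restriction along an endofunctor over the
identity. -/
abbrev opUnit {u : C ⥤ C} (θ : u ⟶ 𝟭 C) (G : Cᵒᵖ ⥤ ModZ) : G ⟶ u.op ⋙ G := opMap θ G

theorem map_opUnit {u : C ⥤ C} (θ : u ⟶ 𝟭 C) (G : Cᵒᵖ ⥤ ModZ) {i : ℕ} (e : CatCohomology G i) :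
    map (opUnit θ G) i e = pullback u.op G i e :=
  (congrArg (map (opUnit θ G) i) (pullback_id G e).symm).trans (map_opMap_pullback θ G e)

theorem pullback_const_op_eq_zero (d : D) (G : Dᵒᵖ ⥤ ModZ) {i : ℕ}
    (e : CatCohomology G (i + 1)) :
    pullback ((Functor.const C).obj d).op G (i + 1) e = 0 :=
  pullback_const_eq_zero (C := Cᵒᵖ) (Opposite.op d) G e

end CatCohomology

/-! ### Pointed wheels and maps of degree one. -/

/-- The category of pointed wheels and pointed maps of degree one, a model for the opposite of the
simplex category. -/
structure SimplexWheel : Type where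
  /-- the number of vertices -/
  size : ℕ+

namespace SimplexWheel

/-- A pointed map of degree one, lifted to the universal covers. -/
@[ext]
structure Hom (m n : SimplexWheel) : Type where
  toFun : ℤ → ℤ
  monotone : Monotone toFun
  map_zero : toFun 0 = 0
  map_add_size : ∀ a : ℤ, toFun (a + (m.size : ℤ)) = toFun a + (n.size : ℤ)

instance : SmallCategory SimplexWheel where
  Hom := Hom
  id m := ⟨fun a => a, fun _ _ h => h, rfl, fun _ => rfl⟩
  comp f g := ⟨fun a => g.toFun (f.toFun a), fun _ _ h => g.monotone (f.monotone h),
    by rw [f.map_zero, g.map_zero], fun a => by rw [f.map_add_size, g.map_add_size]⟩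

theorem size_pos (m : SimplexWheel) : (0 : ℤ) < m.size := by exact_mod_cast m.size.pos

@[simp] theorem id_toFun (m : SimplexWheel) (a : ℤ) : Hom.toFun (𝟙 m) a = a := rfl

@[simp] theorem comp_toFun {m n p : SimplexWheel} (f : m ⟶ n) (g : n ⟶ p) (a : ℤ) :
    Hom.toFun (f ≫ g) a = g.toFun (f.toFun a) := rfl

namespace Hom
variable {m n : SimplexWheel} (f : m ⟶ n)

theorem map_add_mul (a k : ℤ) :
    f.toFun (a + k * (m.size : ℤ)) = f.toFun a + k * (n.size : ℤ) := by
  induction k using Int.induction_on with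
  | zero => simp
  | succ i ih =>
    rw [show a + ((i : ℤ) + 1) * (m.size : ℤ) = a + (i : ℤ) * (m.size : ℤ) + (m.size : ℤ) by ring,
      f.map_add_size, ih]
    ring
  | pred i ih =>
    have h := f.map_add_size (a + (-(i : ℤ) - 1) * (m.size : ℤ))
    rw [show a + (-(i : ℤ) - 1) * (m.size : ℤ) + (m.size : ℤ) = a + -(i : ℤ) * (m.size : ℤ) by ring,
      ih] at h
    linarith

theorem map_mul (k : ℤ) : f.toFun (k * (m.size : ℤ)) = k * (n.size : ℤ) := by
  have h := f.map_add_mul 0 k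
  rwa [zero_add, f.map_zero, zero_add] at h

theorem map_size : f.toFun (m.size : ℤ) = (n.size : ℤ) := by
  simpa using f.map_mul 1

theorem map_nonneg {a : ℤ} (h : 0 ≤ a) : 0 ≤ f.toFun a := by
  have := f.monotone h
  rwa [f.map_zero] at this

theorem map_le {a : ℤ} (h : a ≤ m.size) : f.toFun a ≤ n.size := by
  have := f.monotone h
  rwa [f.map_size] at this

theorem ext_of_lt {f g : m ⟶ n} (h : ∀ r : ℤ, 0 ≤ r → r < m.size → f.toFun r = g.toFun r) :
    f = g := by
  refine Hom.ext (funext fun a => ?_)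
  have hm := m.size_pos
  rw [← Int.emod_add_ediv_mul a (m.size : ℤ), f.map_add_mul, g.map_add_mul,
    h _ (Int.emod_nonneg _ hm.ne') (Int.emod_lt_of_pos _ hm)]

end Hom

/-- A map of wheels prescribed on a fundamental domain. -/
def ofBlock (m n : SimplexWheel) (g : ℤ → ℤ) (h0 : g 0 = 0)
    (hmono : ∀ a b : ℤ, 0 ≤ a → a ≤ b → b < m.size → g a ≤ g b)
    (hle : ∀ a : ℤ, 0 ≤ a → a < m.size → g a ≤ n.size) : m ⟶ n where
  toFun a := a / (m.size : ℤ) * (n.size : ℤ) + g (a % (m.size : ℤ))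
  monotone a b hab := by
    have hm := m.size_pos
    have hn := n.size_pos
    have ha := Int.emod_nonneg a hm.ne'
    have ha' := Int.emod_lt_of_pos a hm
    have hb := Int.emod_nonneg b hm.ne'
    have hb' := Int.emod_lt_of_pos b hm
    rcases (Int.ediv_le_ediv hm hab).eq_or_lt with h | h
    · have : a % (m.size : ℤ) ≤ b % (m.size : ℤ) := by
        have h1 := Int.emod_add_mul_ediv a (m.size : ℤ)
        have h2 := Int.emod_add_mul_ediv b (m.size : ℤ)
        rw [h] at h1
        linarith
      dsimp only
      rw [h]
      linarith [hmono _ _ ha this hb']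
    · have h1 := hle _ ha ha'
      have h2 := hmono 0 _ le_rfl hb hb'
      rw [h0] at h2
      dsimp only
      nlinarith
  map_zero := by simp [h0]
  map_add_size a := by
    rw [Int.add_emod_right, Int.add_ediv_of_dvd_right dvd_rfl, Int.ediv_self m.size_pos.ne']
    ring

theorem ofBlock_toFun {m n : SimplexWheel} {g : ℤ → ℤ} {h0 hmono hle} {r : ℤ} (hr : 0 ≤ r)
    (hr' : r < m.size) : (ofBlock m n g h0 hmono hle).toFun r = g r := by
  change r / (m.size : ℤ) * (n.size : ℤ) + g (r % (m.size : ℤ)) = g r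
  rw [Int.ediv_eq_zero_of_lt hr hr', Int.emod_eq_of_lt hr hr', zero_mul, zero_add]

/-- The wheel with one vertex. -/
abbrev one : SimplexWheel := ⟨1⟩

/-- The wheel with one more vertex. -/
abbrev succ (m : SimplexWheel) : SimplexWheel := ⟨m.size + 1⟩

theorem succ_size (m : SimplexWheel) : ((succ m).size : ℤ) = m.size + 1 := by
  simp

theorem lt_succ {m : SimplexWheel} {r : ℤ} : r < (succ m).size ↔ r ≤ m.size := by
  rw [succ_size, Int.lt_add_one_iff]

/-- The map induced by `f` on wheels with one vertex added at the end of the period. -/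
def succMap {m n : SimplexWheel} (f : m ⟶ n) : succ m ⟶ succ n :=
  ofBlock _ _ f.toFun f.map_zero (fun _ _ _ h _ => f.monotone h) fun _ _ h =>
    (lt_succ.2 (f.map_le (lt_succ.1 h))).le

theorem succMap_toFun {m n : SimplexWheel} (f : m ⟶ n) {r : ℤ} (h : 0 ≤ r) (h' : r ≤ m.size) :
    (succMap f).toFun r = f.toFun r :=
  ofBlock_toFun h (lt_succ.2 h')

/-- The shift functor adding one vertex. -/
def shift : SimplexWheel ⥤ SimplexWheel where
  obj := succ
  map := succMap
  map_id m := Hom.ext_of_lt fun r h h' => succMap_toFun _ h (lt_succ.1 h')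
  map_comp f g := Hom.ext_of_lt fun r h h' => by
    rw [comp_toFun, succMap_toFun _ h (lt_succ.1 h'), succMap_toFun _ h (lt_succ.1 h'),
      succMap_toFun _ (f.map_nonneg h) (f.map_le (lt_succ.1 h')), comp_toFun]

/-- The collapse of the added edge. -/
def collapseLast (m : SimplexWheel) : succ m ⟶ m :=
  ofBlock (succ m) m (fun r => r) rfl (fun _ _ _ h _ => h) fun _ _ h => lt_succ.1 h

theorem collapseLast_toFun (m : SimplexWheel) {r : ℤ} (h : 0 ≤ r) (h' : r ≤ m.size) :
    (collapseLast m).toFun r = r :=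
  ofBlock_toFun (g := fun r => r) h (lt_succ.2 h')

/-- The collapse of the added edge, as a natural transformation. -/
def shiftToId : shift ⟶ 𝟭 SimplexWheel where
  app := collapseLast
  naturality m n f := Hom.ext_of_lt fun r h h' => by
    have h'' := lt_succ.1 h'
    change (collapseLast n).toFun ((succMap f).toFun r) = f.toFun ((collapseLast m).toFun r)
    rw [succMap_toFun f h h'', collapseLast_toFun n (f.map_nonneg h) (f.map_le h''),
      collapseLast_toFun m h h'']

/-- The collapse of all edges but the added one. -/
def collapseInit (m : SimplexWheel) : succ m ⟶ one :=
  ofBlock (succ m) one (fun _ => 0) rfl (fun _ _ _ _ _ => le_rfl) fun _ _ _ => one.size_pos.le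

theorem collapseInit_toFun (m : SimplexWheel) {r : ℤ} (h : 0 ≤ r) (h' : r ≤ m.size) :
    (collapseInit m).toFun r = 0 :=
  ofBlock_toFun (g := fun _ => 0) h (lt_succ.2 h')

/-- The collapse of all edges but the added one, as a natural transformation. -/
def shiftToOne : shift ⟶ (Functor.const SimplexWheel).obj one where
  app := collapseInit
  naturality m n f := Hom.ext_of_lt fun r h h' => by
    have h'' := lt_succ.1 h'
    change (collapseInit n).toFun ((succMap f).toFun r) = (collapseInit m).toFun r
    rw [succMap_toFun f h h'', collapseInit_toFun n (f.map_nonneg h) (f.map_le h''),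
      collapseInit_toFun m h h'']

theorem eq_zero_of_lt_one {r : ℤ} (h : 0 ≤ r) (h' : r < one.size) : r = 0 :=
  le_antisymm (Int.lt_add_one_iff.1 h') h

/-- The inclusion of the base vertex. -/
def oneToShift : (Functor.const SimplexWheel).obj one ⟶ shift where
  app m := ofBlock one (succ m) (fun _ => 0) rfl (fun _ _ _ _ _ => le_rfl)
    fun _ _ _ => (succ m).size_pos.le
  naturality m n f := Hom.ext_of_lt fun r h h' => by
    obtain rfl := eq_zero_of_lt_one h h'
    exact (Hom.map_zero _).trans (Hom.map_zero _).symm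

/-- The endomorphism of the extended wheel collapsing all edges between `t` and the last vertex. -/
def clip (m : SimplexWheel) (t : ℤ) : succ m ⟶ succ m :=
  ofBlock _ _ (fun r => min r (max t 0)) (by simp) (fun _ _ _ h _ => min_le_min_right _ h)
    fun _ _ h => (min_le_left _ _).trans h.le

theorem clip_toFun (m : SimplexWheel) (t : ℤ) {r : ℤ} (h : 0 ≤ r) (h' : r ≤ m.size) :
    (clip m t).toFun r = min r (max t 0) :=
  ofBlock_toFun h (lt_succ.2 h')

/-- A monotone map commutes with min and max. The parameter t is moved to `f.toFun t`, which is the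
variance built into `paths`, so the maps `clip` form a homotopy. -/
theorem clip_naturality {m n : SimplexWheel} (f : m ⟶ n) (t : ℤ) :
    clip m t ≫ succMap f = succMap f ≫ clip n (f.toFun t) :=
  Hom.ext_of_lt fun r h h' => by
    have h'' := lt_succ.1 h'
    rw [comp_toFun, comp_toFun, clip_toFun m t h h'', succMap_toFun f h h'',
      clip_toFun n _ (f.map_nonneg h) (f.map_le h''),
      succMap_toFun f (le_min h (le_max_right _ _)) ((min_le_left _ _).trans h''),
      f.monotone.map_min, f.monotone.map_max, f.map_zero]

theorem clip_zero (m : SimplexWheel) : clip m 0 = shiftToOne.app m ≫ oneToShift.app m :=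
  Hom.ext_of_lt fun r h h' => by
    have h1 : (shiftToOne.app m).toFun r = 0 := collapseInit_toFun m h (lt_succ.1 h')
    rw [clip_toFun m 0 h (lt_succ.1 h'), comp_toFun, h1, Hom.map_zero]
    simp [h]

theorem clip_size (m : SimplexWheel) : clip m m.size = 𝟙 _ :=
  Hom.ext_of_lt fun r h h' => by
    rw [clip_toFun m _ h (lt_succ.1 h'), max_eq_left m.size_pos.le,
      min_eq_left (lt_succ.1 h'), id_toFun]

end SimplexWheel

/-! ### Homotopy invariance for degree-one maps. -/

namespace SimplexWheel
open CatCohomology Opposite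

/-- The map from a functor to its shift is zero on cohomology in positive degrees. -/
theorem map_shiftToId_eq_zero (G : SimplexWheelᵒᵖ ⥤ ModZ) {i : ℕ}
    (e : CatCohomology G (i + 1)) : map (opUnit shiftToId G) (i + 1) e = 0 := by
  refine (map_opUnit shiftToId G e).trans ?_
  have h := map_opMap_pullback shiftToOne G e
  have h0 : pullback ((Functor.const SimplexWheel).obj one).op G (i + 1) e = 0 :=
    pullback_const_op_eq_zero one G e
  rw [h0, _root_.map_zero] at h
  exact h.symm

/-- The inclusion s of the old vertices splits the collapse. It is not natural in m, so it gives
injectivity at each object but no splitting of functors. -/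
theorem collapseLast_app_injective (G : SimplexWheelᵒᵖ ⥤ ModZ) (m : SimplexWheel) :
    Function.Injective (G.map (collapseLast m).op) := by
  let s : m ⟶ succ m := ofBlock m (succ m) (fun r => r) rfl (fun _ _ _ h _ => h)
    fun _ _ h => (lt_succ.2 h.le).le
  have hs : s ≫ collapseLast m = 𝟙 m := Hom.ext_of_lt fun r h h' => by
    have h1 : s.toFun r = r := ofBlock_toFun (g := fun r => r) h h'
    rw [comp_toFun, h1, collapseLast_toFun m h h'.le, id_toFun]
  intro x y hxy
  have h2 : ∀ z, G.map s.op (G.map (collapseLast m).op z) = z := fun z =>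
    (ModZ.map_comp_apply G _ _ z).symm.trans
      ((congrArg (fun g : m ⟶ m => G.map g.op z) hs).trans (ModZ.map_id_apply G z))
  rw [← h2 x, ← h2 y, hxy]

instance (G : SimplexWheelᵒᵖ ⥤ ModZ) : Mono (opUnit shiftToId G) :=
  ModZ.mono_of_injective _ fun c => collapseLast_app_injective G c.unop

/-- The cohomology of a functor restricted along a constant functor is invariant under pullback. -/
theorem pullback_const_eq_self (u : SimplexWheel ⥤ SimplexWheel) (G : SimplexWheelᵒᵖ ⥤ ModZ)
    {i : ℕ} (e : CatCohomology (((Functor.const SimplexWheel).obj one).op ⋙ G) i) :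
    pullback u.op (((Functor.const SimplexWheel).obj one).op ⋙ G) i e = e := by
  -- On a constant functor both collapses act as the identity, so pullbacks along the identity,
  -- `shift` and the constant functor coincide.
  have key : pullback ((Functor.const SimplexWheel).obj one).op
      (((Functor.const SimplexWheel).obj one).op ⋙ G) i e = e := by
    have h1 := map_opUnit shiftToId (((Functor.const SimplexWheel).obj one).op ⋙ G) e
    have h2 := map_opMap_pullback shiftToOne (((Functor.const SimplexWheel).obj one).op ⋙ G) e
    have h3 : opUnit shiftToId (((Functor.const SimplexWheel).obj one).op ⋙ G) = 𝟙 _ :=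
      ModZ.natTrans_ext fun c x => ModZ.map_id_apply G x
    have h4 : opMap shiftToOne (((Functor.const SimplexWheel).obj one).op ⋙ G) = 𝟙 _ :=
      ModZ.natTrans_ext fun c x => ModZ.map_id_apply G x
    rw [h3] at h1
    rw [h4] at h2
    exact (map_id _ _).symm.trans (h2.trans (h1.symm.trans (map_id _ _)))
  refine (congrArg _ key).symm.trans ?_
  exact (pullback_pullback u.op ((Functor.const SimplexWheel).obj one).op
    (((Functor.const SimplexWheel).obj one).op ⋙ G) e).trans key

/-- The functor of functions on the universal cover. -/
def paths : (SimplexWheelᵒᵖ ⥤ ModZ) ⥤ (SimplexWheelᵒᵖ ⥤ ModZ) where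
  obj G :=
    { obj := fun c => ModuleCat.of ℤ (ℤ → G.obj c)
      map := fun f => ModZ.homMk (fun y t => G.map f (y (f.unop.toFun t)))
        fun _ _ => funext fun _ => _root_.map_add _ _ _
      map_id := fun c => ModZ.hom_ext fun y => funext fun t => ModZ.map_id_apply G _
      map_comp := fun f g => ModZ.hom_ext fun y => funext fun t => ModZ.map_comp_apply G f g _ }
  map φ :=
    { app := fun c => ModZ.homMk (fun y t => φ.app c (y t))
        fun _ _ => funext fun _ => _root_.map_add _ _ _
      naturality := fun c d f => ModZ.hom_ext fun y => funext fun t =>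
        ModZ.naturality_apply φ f _ }

instance : paths.Additive where
  map_add := rfl

theorem paths_shortExact {S : ShortComplex (SimplexWheelᵒᵖ ⥤ ModZ)} (hS : S.ShortExact) :
    (S.map paths).ShortExact :=
  ShortComplex.shortExact_of_pointwise
    (fun c x y h => funext fun t => hS.injective_app c (congrFun h t))
    (fun c x hx => by
      choose y hy using fun t => hS.exact_app c (x t) (congrFun hx t)
      exact ⟨y, funext hy⟩)
    (fun c x => by
      choose y hy using fun t => hS.surjective_app c (x t)
      exact ⟨y, funext hy⟩)

/-- The evaluation of functions at the end of the `n`-th period. -/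
def evalPath (n : ℤ) : paths ⟶ 𝟭 _ where
  app G :=
    { app := fun c => ModZ.homMk (fun y : ℤ → G.obj c => y (n * c.unop.size)) fun _ _ => rfl
      naturality := fun c d f => ModZ.hom_ext fun y : ℤ → G.obj c => by
        exact congrArg (fun t => G.map f (y t)) (f.unop.map_mul n) }
  naturality _ _ _ := rfl

/-- The restriction of functions to a fundamental domain. -/
def restrictPath (G : SimplexWheelᵒᵖ ⥤ ModZ) : paths.obj G ⟶ paths.obj G where
  app c := ModZ.homMk (fun (y : ℤ → G.obj c) t => y (max 0 (min t c.unop.size))) fun _ _ => rfl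
  naturality c d f := ModZ.hom_ext fun y : ℤ → G.obj c => funext fun t => by
    refine congrArg (fun t => G.map f (y t)) ?_
    have := f.unop.map_size
    rw [f.unop.monotone.map_max, f.unop.monotone.map_min, f.unop.map_zero, this]

/-- The translation of functions by a period. -/
def translatePath (n : ℤ) (G : SimplexWheelᵒᵖ ⥤ ModZ) : paths.obj G ⟶ paths.obj G where
  app c := ModZ.homMk (fun (y : ℤ → G.obj c) t => y (t + n * c.unop.size)) fun _ _ => rfl
  naturality c _ f := ModZ.hom_ext fun y : ℤ → G.obj c => funext fun t =>
    congrArg (fun t => G.map f (y t)) (f.unop.map_add_mul t n)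

/-- The comparison between functions on extended wheels and functions on wheels. -/
def restrictShift (G : SimplexWheelᵒᵖ ⥤ ModZ) :
    shift.op ⋙ paths.obj G ⟶ paths.obj (shift.op ⋙ G) where
  app c := ModZ.homMk
    (fun (y : ℤ → G.obj (shift.op.obj c)) t => y (max 0 (min t c.unop.size))) fun _ _ => rfl
  naturality c d f := ModZ.hom_ext fun y : ℤ → G.obj (shift.op.obj c) => funext fun t => by
    refine congrArg (fun t => G.map (shift.op.map f) (y t)) ?_
    refine (succMap_toFun f.unop (le_max_left _ _)
      (max_le d.unop.size_pos.le (min_le_right _ _))).trans ?_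
    have := f.unop.map_size
    rw [f.unop.monotone.map_max, f.unop.monotone.map_min, f.unop.map_zero, this]

/-- `paths` does not commute with `shift`: the parameter is moved by f on one side and by `succMap
f` on the other. These agree on [0, size], so the square closes after restriction to one period,
which changes neither end of a path. -/
theorem restrictPath_paths_map (G : SimplexWheelᵒᵖ ⥤ ModZ) :
    restrictPath G ≫ paths.map (opUnit shiftToId G) =
      opUnit shiftToId (paths.obj G) ≫ restrictShift G :=
  ModZ.natTrans_ext fun c y => funext fun _ =>
    congrArg (fun t => G.map (collapseLast c.unop).op ((show ℤ → G.obj c from y) t))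
      (collapseLast_toFun c.unop (le_max_left _ _)
        (max_le c.unop.size_pos.le (min_le_right _ _))).symm

theorem restrictPath_evalPath_zero (G : SimplexWheelᵒᵖ ⥤ ModZ) :
    restrictPath G ≫ (evalPath 0).app G = (evalPath 0).app G :=
  ModZ.natTrans_ext fun c y => congrArg (show ℤ → G.obj c from y) (by
    have := c.unop.size_pos
    simp [this.le])

theorem restrictPath_evalPath_one (G : SimplexWheelᵒᵖ ⥤ ModZ) :
    restrictPath G ≫ (evalPath 1).app G = (evalPath 1).app G :=
  ModZ.natTrans_ext fun c y => congrArg (show ℤ → G.obj c from y) (by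
    have := c.unop.size_pos
    simp [this.le])

theorem translatePath_evalPath (n k : ℤ) (G : SimplexWheelᵒᵖ ⥤ ModZ) :
    translatePath n G ≫ (evalPath k).app G = (evalPath (k + n)).app G :=
  ModZ.natTrans_ext fun c y => congrArg (show ℤ → G.obj c from y) (add_mul _ _ _).symm

/-- The two collapses of the wheel with two vertices send its vertex 1 to 0 and to 1. A compatible
family therefore takes related values at both ends over `one`, and the common section g of the
collapses makes them equal. -/
theorem comp_evalPath_zero_eq_one (G : SimplexWheelᵒᵖ ⥤ ModZ)
    (φ : (Functor.const SimplexWheelᵒᵖ).obj (ModuleCat.of ℤ ℤ) ⟶ paths.obj G) :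
    φ ≫ (evalPath 0).app G = φ ≫ (evalPath 1).app G := by
  let x : ∀ m : SimplexWheel, ℤ → G.obj (op m) := fun m => φ.app (op m) (1 : ℤ)
  have hx : ∀ {m n : SimplexWheel} (f : m ⟶ n) (t : ℤ), x m t = G.map f.op (x n (f.toFun t)) :=
    fun f t => congrFun (ModZ.naturality_apply φ f.op (1 : ℤ)) t
  let two : SimplexWheel := ⟨2⟩
  let f₀ : two ⟶ one := ofBlock two one (fun _ => 0) rfl (fun _ _ _ _ _ => le_rfl)
    fun _ _ _ => one.size_pos.le
  let f₁ : two ⟶ one := ofBlock two one (fun r => r) rfl (fun _ _ _ h _ => h)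
    fun _ _ h => Int.lt_add_one_iff.1 h
  let g : one ⟶ two := ofBlock one two (fun _ => 0) rfl (fun _ _ _ _ _ => le_rfl)
    fun _ _ _ => two.size_pos.le
  have hg : ∀ f : two ⟶ one, ∀ z, G.map g.op (G.map f.op z) = z := fun f z => by
    have : g ≫ f = 𝟙 one := Hom.ext_of_lt fun r h h' => by
      obtain rfl := eq_zero_of_lt_one h h'
      rw [Hom.map_zero, Hom.map_zero]
    exact (ModZ.map_comp_apply G _ _ z).symm.trans
      ((congrArg (fun g : one ⟶ one => G.map g.op z) this).trans (ModZ.map_id_apply G z))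
  have h₀ : f₀.toFun 1 = 0 := ofBlock_toFun (g := fun _ => 0) zero_le_one (by simp [two])
  have h₁ : f₁.toFun 1 = 1 := ofBlock_toFun (g := fun r => r) zero_le_one (by simp [two])
  have hone : x one 0 = x one 1 := by
    have e₀ := hx f₀ 1
    have e₁ := hx f₁ 1
    rw [h₀] at e₀
    rw [h₁] at e₁
    rw [← hg f₀ (x one 0), ← hg f₁ (x one 1), ← e₀, ← e₁]
  refine NatTrans.ext (funext fun c => ModZ.hom_ext_int ?_)
  change x c.unop (0 * c.unop.size) = x c.unop (1 * c.unop.size)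
  let u : c.unop ⟶ one := ofBlock _ one (fun _ => 0) rfl (fun _ _ _ _ _ => le_rfl)
    fun _ _ _ => one.size_pos.le
  rw [hx u, hx u, u.map_mul, u.map_mul]
  simpa using congrArg (G.map u.op) hone

/-- Dimension shifting along the embedding of G in its shift, which is zero on cohomology in
positive degrees. After `restrictPath`, the class thus becomes a connecting image from one degree
lower. -/
theorem map_evalPath_zero_eq_one (G : SimplexWheelᵒᵖ ⥤ ModZ) {i : ℕ}
    (e : CatCohomology (paths.obj G) i) :
    map ((evalPath 0).app G) i e = map ((evalPath 1).app G) i e := by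
  induction i generalizing G with
  | zero =>
    obtain ⟨φ, rfl⟩ := (Ext.mk₀_bijective _ _).2 e
    refine (Ext.mk₀_comp_mk₀ _ _).trans (Eq.trans ?_ (Ext.mk₀_comp_mk₀ _ _).symm)
    exact congrArg Ext.mk₀ (comp_evalPath_zero_eq_one G φ)
  | succ i ih =>
    let S := cokernelShortComplex (opUnit shiftToId G)
    have hS : S.ShortExact := shortExact_cokernelShortComplex _
    have hPS := paths_shortExact hS
    have h0 : map (S.map paths).f (i + 1) (map (restrictPath G) (i + 1) e) = 0 := by
      refine (map_comp (restrictPath G) (paths.map (opUnit shiftToId G)) e).symm.trans ?_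
      rw [restrictPath_paths_map, map_comp, map_shiftToId_eq_zero, _root_.map_zero]
      rfl
    obtain ⟨q, hq⟩ := exists_δ_eq hPS _ h0
    have hn : ∀ n, map ((evalPath n).app G) (i + 1) (map (restrictPath G) (i + 1) e) =
        δ hS i (map ((evalPath n).app S.X₃) i q) := fun n => by
      rw [← hq]
      exact δ_naturality hPS hS
        ⟨(evalPath n).app S.X₁, (evalPath n).app S.X₂, (evalPath n).app S.X₃, rfl, rfl⟩ q
    rw [← restrictPath_evalPath_zero, ← restrictPath_evalPath_one, map_comp, map_comp, hn, hn]
    exact congrArg (δ hS i) (ih S.X₃ q)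

/-- Translation by periods reduces each step from n to n + 1 to the step from 0 to 1. Several
periods are needed because a dilation by N turns N periods of the original wheel into one. -/
theorem map_evalPath_natCast (G : SimplexWheelᵒᵖ ⥤ ModZ) (n : ℕ) {i : ℕ}
    (e : CatCohomology (paths.obj G) i) :
    map ((evalPath n).app G) i e = map ((evalPath 0).app G) i e := by
  induction n with
  | zero => rfl
  | succ n ih =>
    rw [← ih, Nat.cast_succ, add_comm, ← translatePath_evalPath, map_comp,
      ← map_evalPath_zero_eq_one, ← map_comp, translatePath_evalPath, zero_add]

/-- The two ends of a homotopy induce the same map on cohomology. -/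
theorem map_homotopy {X Y : SimplexWheelᵒᵖ ⥤ ModZ} (h : X ⟶ paths.obj Y) (n : ℕ) {i : ℕ}
    (e : CatCohomology X i) :
    map (h ≫ (evalPath n).app Y) i e = map (h ≫ (evalPath 0).app Y) i e := by
  rw [map_comp, map_comp, map_evalPath_natCast]

/-- Endofunctors of the category of pointed wheels that multiply the number of vertices by `N`
without changing the maps. -/
structure IsDilation (u : SimplexWheel ⥤ SimplexWheel) (N : ℕ+) : Prop where
  size_obj : ∀ m, (u.obj m).size = N * m.size
  map_toFun : ∀ {m n : SimplexWheel} (f : m ⟶ n) (a : ℤ), (u.map f).toFun a = f.toFun a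

theorem isDilation_id : IsDilation (𝟭 _) 1 := ⟨fun _ => (one_mul _).symm, fun _ _ => rfl⟩

theorem IsDilation.comp {u v : SimplexWheel ⥤ SimplexWheel} {N M : ℕ+} (hu : IsDilation u N)
    (hv : IsDilation v M) : IsDilation (u ⋙ v) (M * N) where
  size_obj m := by
    rw [Functor.comp_obj, hv.size_obj, hu.size_obj, mul_assoc]
  map_toFun f a := by
    rw [Functor.comp_map, hv.map_toFun, hu.map_toFun]

/-- The dilation of wheels. -/
def dilate (N : ℕ+) : SimplexWheel ⥤ SimplexWheel where
  obj m := ⟨N * m.size⟩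
  map {m n} f := ⟨f.toFun, f.monotone, f.map_zero, fun a => by
    push_cast
    exact f.map_add_mul a N⟩

theorem isDilation_dilate (N : ℕ+) : IsDilation (dilate N) N := ⟨fun _ => rfl, fun _ _ => rfl⟩

section Dilation
variable {u : SimplexWheel ⥤ SimplexWheel} {N : ℕ+} (hu : IsDilation u N)
  (G : SimplexWheelᵒᵖ ⥤ ModZ)

/-- The contraction of the restriction of a shifted functor along a dilation. -/
def dilationContraction : u.op ⋙ shift.op ⋙ G ⟶ paths.obj (u.op ⋙ shift.op ⋙ G) where
  app c := ModZ.homMk (fun (x : G.obj (op (succ (u.obj c.unop)))) (t : ℤ) =>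
    (show G.obj (op (succ (u.obj c.unop))) from G.map (clip (u.obj c.unop) t).op x))
    fun _ _ => funext fun _ => _root_.map_add _ _ _
  naturality c d f := ModZ.hom_ext fun x => funext fun t => by
    refine (ModZ.map_comp_apply G _ _ _).symm.trans
      (Eq.trans ?_ (ModZ.map_comp_apply G _ _ _))
    refine congrArg (fun g : succ (u.obj d.unop) ⟶ succ (u.obj c.unop) => G.map g.op x) ?_
    have := clip_naturality (u.map f.unop) t
    rw [hu.map_toFun] at this
    exact this

theorem dilationContraction_evalPath :
    dilationContraction hu G ≫ (evalPath (N : ℕ)).app _ = 𝟙 _ :=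
  ModZ.natTrans_ext fun c x => by
    have h : clip (u.obj c.unop) ((N : ℕ) * (c.unop.size : ℤ)) = 𝟙 _ := by
      have h' := clip_size (u.obj c.unop)
      rw [hu.size_obj] at h'
      push_cast at h'
      exact h'
    exact (congrArg (fun g : succ (u.obj c.unop) ⟶ succ (u.obj c.unop) => G.map g.op x) h).trans
      (ModZ.map_id_apply G x)

theorem dilationContraction_evalPath_zero :
    dilationContraction hu G ≫ (evalPath 0).app _ =
      u.op.whiskerLeft (opMap oneToShift G) ≫ u.op.whiskerLeft (opMap shiftToOne G) :=
  ModZ.natTrans_ext fun c x => by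
    have h : clip (u.obj c.unop) (0 * (c.unop.size : ℤ)) =
        shiftToOne.app (u.obj c.unop) ≫ oneToShift.app (u.obj c.unop) := by
      rw [zero_mul, clip_zero]
    exact (congrArg (fun g : succ (u.obj c.unop) ⟶ succ (u.obj c.unop) => G.map g.op x) h).trans
      (ModZ.map_comp_apply G _ _ x)

/-- The homotopy `clip` ends at the identity after N periods and starts, at t = 0, at a map through
the wheel with one vertex. So shifted functors have the cohomology of a constant functor, even after
dilation. -/
theorem eq_map_map_of_isDilation (hu : IsDilation u N) (G : SimplexWheelᵒᵖ ⥤ ModZ)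
    {i : ℕ} (e : CatCohomology (u.op ⋙ shift.op ⋙ G) i) :
    map (u.op.whiskerLeft (opMap shiftToOne G)) i
      (map (u.op.whiskerLeft (opMap oneToShift G)) i e) = e := by
  rw [← map_comp, ← dilationContraction_evalPath_zero hu, ← map_homotopy _ N,
    dilationContraction_evalPath, map_id]

/-- Dilations induce isomorphisms on the cohomology of shifted functors. -/
theorem bijective_pullback_dilation (hu : IsDilation u N) (G : SimplexWheelᵒᵖ ⥤ ModZ) (i : ℕ) :
    Function.Bijective (pullback u.op (shift.op ⋙ G) i) := by
  have hconst := pullback_const_eq_self u G (i := i)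
  constructor
  · rw [injective_iff_map_eq_zero]
    intro e he
    have h1 : map (opMap oneToShift G) i e = 0 := by
      refine (hconst _).symm.trans ((pullback_map u.op (opMap oneToShift G) e).trans ?_)
      rw [he]
      exact _root_.map_zero _
    have h2 : map (opMap shiftToOne G) i (map (opMap oneToShift G) i e) = e :=
      eq_map_map_of_isDilation isDilation_id G e
    rw [← h2, h1, _root_.map_zero]
  · intro e
    refine ⟨map (opMap shiftToOne G) i (map (u.op.whiskerLeft (opMap oneToShift G)) i e), ?_⟩
    refine (pullback_map u.op (opMap shiftToOne G) _).trans ?_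
    refine Eq.trans ?_ (eq_map_map_of_isDilation hu G e)
    exact congrArg (map (u.op.whiskerLeft (opMap shiftToOne G)) i) (hconst _)

end Dilation

end SimplexWheel

/-! ### Pointed wheels with maps of all degrees, and coinduction along coverings. -/

/-- The category of pointed wheels and pointed maps of arbitrary degree. -/
structure PointedWheel : Type where
  /-- the number of vertices -/
  size : ℕ+

namespace PointedWheel
open Opposite CatCohomology

/-- A pointed map of wheels, lifted to the universal covers. -/
structure Hom (m n : PointedWheel) : Type where
  toFun : ℤ → ℤ
  degree : ℕ+
  monotone : Monotone toFun
  map_zero : toFun 0 = 0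
  map_add_size : ∀ a : ℤ, toFun (a + (m.size : ℤ)) = toFun a + (degree : ℤ) * (n.size : ℤ)

theorem size_pos (m : PointedWheel) : (0 : ℤ) < m.size := by exact_mod_cast m.size.pos

namespace Hom
variable {m n : PointedWheel}

theorem map_add_mul (f : Hom m n) (a k : ℤ) :
    f.toFun (a + k * (m.size : ℤ)) = f.toFun a + k * ((f.degree : ℤ) * (n.size : ℤ)) :=
  LambdaR.Lift.map_add_mul (m := ⟨m.size⟩) (n := ⟨n.size⟩)
    ⟨f.toFun, f.degree, f.monotone, f.map_add_size⟩ a k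

theorem degree_eq (f : Hom m n) : (f.degree : ℤ) * (n.size : ℤ) = f.toFun m.size := by
  simpa [f.map_zero] using (f.map_add_size 0).symm

@[ext]
theorem ext {f g : Hom m n} (h : f.toFun = g.toFun) : f = g := by
  have h' : (f.degree : ℤ) = g.degree := by
    refine mul_right_cancel₀ n.size_pos.ne' ?_
    rw [f.degree_eq, g.degree_eq, h]
  have h'' : f.degree = g.degree := by exact_mod_cast h'
  cases f
  cases g
  cases h
  cases h''
  rfl

end Hom

instance : SmallCategory PointedWheel where
  Hom := Hom
  id m := ⟨fun a => a, 1, fun _ _ h => h, rfl, fun _ => by simp⟩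
  comp f g := ⟨fun a => g.toFun (f.toFun a), f.degree * g.degree,
    fun _ _ h => g.monotone (f.monotone h), by rw [f.map_zero, g.map_zero], fun a => by
      rw [f.map_add_size, g.map_add_mul]
      push_cast
      ring⟩

/-- The inclusion of maps of degree one. -/
def ofSimplex : SimplexWheel ⥤ PointedWheel where
  obj m := ⟨m.size⟩
  map f := ⟨f.toFun, 1, f.monotone, f.map_zero, fun a => by simpa using f.map_add_size a⟩

/-- The lift of a map to finite coverings. -/
def coverMap {m n : PointedWheel} (f : m ⟶ n) (k : ℕ+) :
    (⟨k * m.size⟩ : SimplexWheel) ⟶ ⟨k * f.degree * n.size⟩ :=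
  ⟨f.toFun, f.monotone, f.map_zero, fun a => by
    push_cast
    rw [mul_assoc]
    exact f.map_add_mul a k⟩

/-- The identity of `ℤ` as a map between wheels of the same size. -/
def castMap {m n : SimplexWheel} (h : m.size = n.size) : m ⟶ n :=
  ⟨fun a => a, fun _ _ h => h, rfl, fun _ => by rw [h]⟩

/-- The covering of degree `k`. -/
def covering (k : ℕ+) {m : SimplexWheel} {n : PointedWheel} (h : m.size = k * n.size) :
    ofSimplex.obj m ⟶ n :=
  ⟨fun a => a, k, fun _ _ h => h, rfl, fun a => by
    change a + (m.size : ℤ) = _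
    rw [h]
    push_cast
    rfl⟩

theorem map_apply_eq (G : SimplexWheelᵒᵖ ⥤ ModZ) {s : ℕ+}
    (y : ∀ k : ℕ+, G.obj (op ⟨k * s⟩)) {k k' : ℕ+} {x : SimplexWheel}
    (g : x ⟶ ⟨k * s⟩) (g' : x ⟶ ⟨k' * s⟩) (hk : k = k') (hg : g.toFun = g'.toFun) :
    G.map g.op (y k) = G.map g'.op (y k') := by
  subst hk
  obtain rfl : g = g' := SimplexWheel.Hom.ext hg
  rfl

theorem map_map_eq (F : PointedWheelᵒᵖ ⥤ ModZ) {m n n' p : PointedWheel} (f : n ⟶ m) (g : p ⟶ n)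
    (f' : n' ⟶ m) (g' : p ⟶ n') (h : (g ≫ f).toFun = (g' ≫ f').toFun) (x : F.obj (op m)) :
    F.map g.op (F.map f.op x) = F.map g'.op (F.map f'.op x) := by
  rw [← ModZ.map_comp_apply, ← ModZ.map_comp_apply, ← op_comp, ← op_comp, Hom.ext h]

theorem map_map_eq_self (F : PointedWheelᵒᵖ ⥤ ModZ) {m n : PointedWheel} (f : n ⟶ m) (g : m ⟶ n)
    (h : (g ≫ f).toFun = fun a => a) (x : F.obj (op m)) :
    F.map g.op (F.map f.op x) = x :=
  (map_map_eq F f g (𝟙 m) (𝟙 m) h x).trans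
    ((congrArg _ (ModZ.map_id_apply F x)).trans (ModZ.map_id_apply F x))

/-- The right adjoint of restriction to maps of degree one, on objects. -/
def coindObj (G : SimplexWheelᵒᵖ ⥤ ModZ) : PointedWheelᵒᵖ ⥤ ModZ where
  -- A pointed map of degree k factors uniquely as a degree-one map followed by the k-fold covering,
  -- so the limit defining the Kan extension is a product over k.
  obj m := ModuleCat.of ℤ (∀ k : ℕ+, G.obj (op ⟨k * m.unop.size⟩))
  map {m n} f := ModZ.homMk
    (fun (y : ∀ k : ℕ+, G.obj (op ⟨k * m.unop.size⟩)) (k : ℕ+) =>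
      (show G.obj (op ⟨k * n.unop.size⟩) from
        G.map (coverMap f.unop k).op (y (k * f.unop.degree))))
    fun _ _ => funext fun _ => _root_.map_add _ _ _
  map_id m := ModZ.hom_ext fun y => funext fun k =>
    (map_apply_eq G y (coverMap (𝟙 m.unop) k) (𝟙 _) (mul_one _) rfl).trans
      (ModZ.map_id_apply G _)
  map_comp f g := ModZ.hom_ext fun y => funext fun k =>
    (map_apply_eq G y (coverMap (g.unop ≫ f.unop) k)
      (coverMap g.unop k ≫ coverMap f.unop (k * g.unop.degree))
      (mul_assoc _ _ _).symm rfl).trans (ModZ.map_comp_apply G _ _ _)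

/-- The right adjoint of restriction to maps of degree one. -/
def coind : (SimplexWheelᵒᵖ ⥤ ModZ) ⥤ (PointedWheelᵒᵖ ⥤ ModZ) where
  obj G := coindObj G
  map φ :=
    { app := fun m => ModZ.homMk (fun y k => φ.app (op ⟨k * m.unop.size⟩) (y k))
        fun _ _ => funext fun _ => _root_.map_add _ _ _
      naturality := fun _ _ _ => ModZ.hom_ext fun _ => funext fun _ =>
        ModZ.naturality_apply φ _ _ }

instance : coind.Additive where
  map_add := rfl

theorem coind_exact :
    Limits.PreservesFiniteLimits coind ∧ Limits.PreservesFiniteColimits coind :=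
  preservesFiniteLimits_and_colimits_of_shortExact _ fun T hT =>
    ShortComplex.shortExact_of_pointwise
      (fun c x y h => funext fun v => hT.injective_app _ (congrFun h v))
      (fun c x hx => by
        choose y hy using fun v => hT.exact_app _ (x v) (congrFun hx v)
        exact ⟨y, funext hy⟩)
      (fun c x => by
        choose y hy using fun v => hT.surjective_app _ (x v)
        exact ⟨y, funext hy⟩)

instance : Limits.PreservesFiniteLimits coind := coind_exact.1
instance : Limits.PreservesFiniteColimits coind := coind_exact.2

/-- The unit of the adjunction. -/
def coindUnit (F : PointedWheelᵒᵖ ⥤ ModZ) : F ⟶ coindObj (ofSimplex.op ⋙ F) where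
  app m := ModZ.homMk
    (fun (x : F.obj m) (k : ℕ+) =>
      (show (ofSimplex.op ⋙ F).obj (op ⟨k * m.unop.size⟩) from
        F.map (covering (m := ⟨k * m.unop.size⟩) k rfl).op x))
    fun _ _ => funext fun _ => _root_.map_add _ _ _
  naturality m n f := ModZ.hom_ext fun x => funext fun k =>
    map_map_eq F f.unop (covering (m := ⟨k * n.unop.size⟩) k rfl)
      (covering (m := ⟨k * f.unop.degree * m.unop.size⟩) (k * f.unop.degree) rfl)
      (ofSimplex.map (coverMap f.unop k)) rfl x

/-- The counit of the adjunction. -/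
def coindCounit (G : SimplexWheelᵒᵖ ⥤ ModZ) : ofSimplex.op ⋙ coindObj G ⟶ G where
  app m := ModZ.homMk
    (fun (y : ∀ k : ℕ+, G.obj (op ⟨k * m.unop.size⟩)) =>
      (show G.obj m from G.map (castMap (one_mul m.unop.size).symm).op (y 1)))
    fun _ _ => _root_.map_add _ _ _
  naturality m n f := ModZ.hom_ext fun (y : ∀ k : ℕ+, G.obj (op ⟨k * m.unop.size⟩)) =>
    (ModZ.map_comp_apply G (coverMap (ofSimplex.map f.unop) 1).op
      (castMap (one_mul n.unop.size).symm).op _).symm.trans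
      ((map_apply_eq G y (castMap (one_mul n.unop.size).symm ≫
        coverMap (ofSimplex.map f.unop) 1)
        (f.unop ≫ castMap (one_mul m.unop.size).symm) rfl rfl).trans
      (ModZ.map_comp_apply G _ _ _))

/-- Restriction to maps of degree one is left adjoint to `coind`. -/
def coindAdjunction : (Functor.whiskeringLeft _ _ ModZ).obj ofSimplex.op ⊣ coind :=
  Adjunction.mkOfUnitCounit
    { unit :=
        { app := coindUnit
          naturality := fun _ _ φ => ModZ.natTrans_ext fun m x => funext fun k =>
            (ModZ.naturality_apply φ (covering (m := ⟨k * m.unop.size⟩) k rfl).op x).symm }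
      counit :=
        { app := coindCounit
          naturality := fun _ _ φ => ModZ.natTrans_ext fun m y =>
            (ModZ.naturality_apply φ (castMap (one_mul m.unop.size).symm).op
              ((show ∀ _ : ℕ+, _ from y) 1)).symm }
      left_triangle := NatTrans.ext (funext fun F => ModZ.natTrans_ext fun m x =>
        map_map_eq_self F (covering (m := ⟨1 * m.unop.size⟩) 1 rfl)
          (ofSimplex.map (castMap (one_mul m.unop.size).symm)) rfl x)
      right_triangle := NatTrans.ext (funext fun G => ModZ.natTrans_ext fun m y => funext fun k =>
        (ModZ.map_comp_apply G _ _ _).symm.trans ((map_apply_eq G y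
          (castMap (one_mul (k * m.unop.size)).symm ≫
            coverMap (covering (m := ⟨k * m.unop.size⟩) k rfl) 1) (𝟙 _) (one_mul k) rfl).trans
          (ModZ.map_id_apply G _))) }

theorem bijective_pullback_coindCounit (G : SimplexWheelᵒᵖ ⥤ ModZ) (i : ℕ) :
    Function.Bijective fun e : CatCohomology (coindObj G) i =>
      map (coindCounit G) i (pullback ofSimplex.op (coindObj G) i e) :=
  bijective_pullback_counit ofSimplex.op coindAdjunction G i

theorem subsingleton_coind (G : SimplexWheelᵒᵖ ⥤ ModZ) (i : ℕ)
    (h : Subsingleton (CatCohomology G i)) : Subsingleton (CatCohomology (coindObj G) i) :=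
  (bijective_pullback_coindCounit G i).1.subsingleton

/-- The component k = 1 is already injective, because a covering of degree one is invertible. -/
instance (F : PointedWheelᵒᵖ ⥤ ModZ) : Mono (coindUnit F) :=
  ModZ.mono_of_injective _ fun m x y h => by
    have h1 := congrFun h 1
    let g : m.unop ⟶ ofSimplex.obj ⟨1 * m.unop.size⟩ :=
      ⟨fun a => a, 1, fun _ _ h => h, rfl, fun a => by simp [ofSimplex]⟩
    have h2 : ∀ z : F.obj m, F.map g.op ((coindUnit F).app m z 1) = z := fun z =>
      map_map_eq_self F (covering (m := ⟨1 * m.unop.size⟩) 1 rfl) g rfl z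
    exact (h2 x).symm.trans ((congrArg (F.map g.op) h1).trans (h2 y))

end PointedWheel

/-! ### Dilations and acyclicity on pointed wheels. -/

namespace PointedWheel
open Opposite CatCohomology SimplexWheel

/-- Multiplication of the number of vertices by `N`. -/
def dilation (N : ℕ+) : PointedWheel ⥤ PointedWheel where
  obj m := ⟨N * m.size⟩
  map {m n} f := ⟨f.toFun, f.degree, f.monotone, f.map_zero, fun a => by
    push_cast
    rw [f.map_add_mul]
    ring⟩

/-- The coverings of degree `N`. -/
def dilationToId (N : ℕ+) : dilation N ⟶ 𝟭 _ where
  app m := covering (m := ⟨N * m.size⟩) N rfl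
  naturality _ _ _ := Hom.ext rfl

/-- The comparison of the restriction of a coinduced functor with the coinduction of a
restriction. -/
def dilationCoindIso (N : ℕ+) (G : SimplexWheelᵒᵖ ⥤ ModZ) :
    (dilation N).op ⋙ coindObj G ≅ coindObj ((dilate N).op ⋙ G) where
  hom :=
    { app := fun m => ModZ.homMk
        (fun (y : ∀ k : ℕ+, G.obj (op ⟨k * (N * m.unop.size)⟩)) (k : ℕ+) =>
          (show G.obj (op ⟨N * (k * m.unop.size)⟩) from
            G.map (castMap (n := ⟨k * (N * m.unop.size)⟩) (mul_left_comm _ _ _)).op (y k)))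
        fun _ _ => funext fun _ => _root_.map_add _ _ _
      naturality := fun m n f => ModZ.hom_ext fun _ => funext fun k =>
        (ModZ.map_comp_apply G (coverMap ((dilation N).map f.unop) k).op
          (castMap (m := ⟨N * (k * n.unop.size)⟩) (n := ⟨k * (N * n.unop.size)⟩)
            (mul_left_comm _ _ _)).op _).symm.trans
          (ModZ.map_comp_apply G (castMap (m := ⟨N * (k * f.unop.degree * m.unop.size)⟩)
            (n := ⟨k * f.unop.degree * (N * m.unop.size)⟩) (mul_left_comm _ _ _)).op
            ((dilate N).map (coverMap f.unop k)).op _) }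
  inv :=
    { app := fun m => ModZ.homMk
        (fun (y : ∀ k : ℕ+, G.obj (op ⟨N * (k * m.unop.size)⟩)) (k : ℕ+) =>
          (show G.obj (op ⟨k * (N * m.unop.size)⟩) from
            G.map (castMap (n := ⟨N * (k * m.unop.size)⟩) (mul_left_comm _ _ _)).op (y k)))
        fun _ _ => funext fun _ => _root_.map_add _ _ _
      naturality := fun m n f => ModZ.hom_ext fun _ => funext fun k =>
        (ModZ.map_comp_apply G ((dilate N).map (coverMap f.unop k)).op
          (castMap (m := ⟨k * (N * n.unop.size)⟩) (n := ⟨N * (k * n.unop.size)⟩)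
            (mul_left_comm _ _ _)).op _).symm.trans
          (ModZ.map_comp_apply G (castMap (m := ⟨k * f.unop.degree * (N * m.unop.size)⟩)
            (n := ⟨N * (k * f.unop.degree * m.unop.size)⟩) (mul_left_comm _ _ _)).op
            (coverMap ((dilation N).map f.unop) k).op _) }
  hom_inv_id := ModZ.natTrans_ext fun m _ => funext fun k =>
    (ModZ.map_comp_apply G (castMap (m := ⟨N * (k * m.unop.size)⟩)
      (n := ⟨k * (N * m.unop.size)⟩) (mul_left_comm _ _ _)).op
      (castMap (mul_left_comm _ _ _)).op _).symm.trans (ModZ.map_id_apply G _)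
  inv_hom_id := ModZ.natTrans_ext fun m _ => funext fun k =>
    (ModZ.map_comp_apply G (castMap (m := ⟨k * (N * m.unop.size)⟩)
      (n := ⟨N * (k * m.unop.size)⟩) (mul_left_comm _ _ _)).op
      (castMap (mul_left_comm _ _ _)).op _).symm.trans (ModZ.map_id_apply G _)

theorem dilationCoindIso_counit (N : ℕ+) (G : SimplexWheelᵒᵖ ⥤ ModZ) :
    ofSimplex.op.whiskerLeft (dilationCoindIso N G).hom ≫ coindCounit ((dilate N).op ⋙ G) =
      (dilate N).op.whiskerLeft (coindCounit G) :=
  ModZ.natTrans_ext fun m (y : ∀ k : ℕ+, G.obj (op ⟨k * (N * m.unop.size)⟩)) =>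
    (ModZ.map_comp_apply G (castMap (m := ⟨N * (1 * m.unop.size)⟩)
      (n := ⟨1 * (N * m.unop.size)⟩) (mul_left_comm _ _ _)).op
      ((dilate N).map (castMap (one_mul m.unop.size).symm)).op (y 1)).symm

/-- Coinduction commutes with dilation and preserves cohomology, so the statement descends to
`bijective_pullback_dilation` for degree-one maps. -/
theorem bijective_pullback_dilation_coind (N : ℕ+) (G : SimplexWheelᵒᵖ ⥤ ModZ) (i : ℕ) :
    Function.Bijective (pullback (dilation N).op (coindObj (shift.op ⋙ G)) i) := by
  set G' := shift.op ⋙ G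
  have h1 := (bijective_pullback_dilation (isDilation_dilate N) G i).comp
    (bijective_pullback_coindCounit G' i)
  have h2 := (bijective_pullback_coindCounit ((dilate N).op ⋙ G') i).comp
    (map_bijective (dilationCoindIso N G') i)
  refine (Function.Bijective.of_comp_iff' h2 _).1 ?_
  refine (congrArg Function.Bijective (funext fun e => ?_)).mpr h1
  refine (congrArg (map _ i) (pullback_map ofSimplex.op (dilationCoindIso N G').hom _)).trans ?_
  refine (map_comp _ _ _).symm.trans ?_
  refine Eq.trans ?_ (pullback_map (dilate N).op (coindCounit G') _).symm
  rw [dilationCoindIso_counit]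
  refine congrArg (map ((dilate N).op.whiskerLeft (coindCounit G')) i) ?_
  exact (pullback_pullback ofSimplex.op (dilation N).op _ e).trans
    (pullback_pullback (dilate N).op ofSimplex.op _ e).symm

/-- Pullback along dilations is injective on the cohomology of the category of pointed wheels. -/
theorem injective_pullback_dilation (N : ℕ+) (F : PointedWheelᵒᵖ ⥤ ModZ) (i : ℕ) :
    Function.Injective (pullback (dilation N).op F i) := by
  -- Every F embeds in the coinduction of a shifted functor, where pullback is bijective in all
  -- degrees.
  have key : ∀ (F : PointedWheelᵒᵖ ⥤ ModZ), ∃ S : ShortComplex (PointedWheelᵒᵖ ⥤ ModZ),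
      S.X₁ = F ∧ S.ShortExact ∧ ∀ i, Function.Bijective (pullback (dilation N).op S.X₂ i) :=
    fun F =>
      have : Mono (coind.map (opUnit shiftToId (ofSimplex.op ⋙ F))) := coind.map_mono _
      have : Mono (coindUnit F ≫ coind.map (opUnit shiftToId (ofSimplex.op ⋙ F))) :=
        @mono_comp _ _ _ _ _ (coindUnit F) inferInstance _ this
      ⟨cokernelShortComplex (coindUnit F ≫ coind.map (opUnit shiftToId (ofSimplex.op ⋙ F))),
        rfl, shortExact_cokernelShortComplex _, bijective_pullback_dilation_coind N _⟩
  induction i generalizing F with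
  | zero =>
    obtain ⟨S, rfl, hS, hb⟩ := key F
    rw [injective_iff_map_eq_zero]
    intro e he
    have h := pullback_map (dilation N).op S.f e
    rw [he, _root_.map_zero] at h
    refine map_f_zero_injective hS ?_
    rw [_root_.map_zero]
    exact (hb 0).1 (h.trans (_root_.map_zero _).symm)
  | succ i ih =>
    obtain ⟨S, rfl, hS, hb⟩ := key F
    rw [injective_iff_map_eq_zero]
    intro e he
    have h := pullback_map (dilation N).op S.f e
    rw [he, _root_.map_zero] at h
    -- Bijectivity for the middle term in degrees i and i + 1, together with injectivity for the
    -- cokernel in degree i, gives injectivity for F in degree i + 1.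
    obtain ⟨q, rfl⟩ := exists_δ_eq hS e ((hb _).1 (h.trans (_root_.map_zero _).symm))
    have h' := pullback_δ (dilation N).op hS q
    rw [he] at h'
    obtain ⟨t, ht⟩ := exists_map_g_eq (shortExact_restrict (dilation N).op hS) _ h'.symm
    obtain ⟨t, rfl⟩ := (hb i).2 t
    have : map S.g i t = q := ih _ ((pullback_map (dilation N).op S.g t).trans ht)
    rw [← this, δ_map_g]

/-- The cohomology of a functor on which the coverings of some degree act by zero vanishes. -/
theorem subsingleton_of_covering_eq_zero (N : ℕ+) (F : PointedWheelᵒᵖ ⥤ ModZ)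
    (h : ∀ m x, F.map ((dilationToId N).app m).op x = 0) (i : ℕ) :
    Subsingleton (CatCohomology F i) := by
  refine subsingleton_of_forall_eq 0 fun e => ?_
  refine injective_pullback_dilation N F i ?_
  have h0 : opUnit (dilationToId N) F = 0 := ModZ.natTrans_ext fun c x => h c.unop x
  rw [← map_opUnit (dilationToId N), h0, CatCohomology.map_zero, _root_.map_zero]

/-- The restriction of a coinduced functor to maps of degree one. -/
def coindRestrictionIso (u : SimplexWheel ⥤ SimplexWheel) (F : PointedWheelᵒᵖ ⥤ ModZ) :
    (u ⋙ ofSimplex).op ⋙ coindObj (ofSimplex.op ⋙ F) ≅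
      pointwisePi fun k => ((u ⋙ dilate k) ⋙ ofSimplex).op ⋙ F :=
  NatIso.ofComponents (fun _ => Iso.refl _) fun {_ _} f =>
    ModZ.hom_ext fun y => funext fun k =>
      map_apply_eq (ofSimplex.op ⋙ F) y (coverMap ((u ⋙ ofSimplex).map f.unop) k)
        ((dilate k).map (u.map f.unop)) (mul_one k) rfl

/-- F embeds in its coinduction, whose restriction along u is a product of restrictions of F along
further dilations. Assuming acyclicity for all dilations at once lets the hypothesis pass to the
cokernel, as the induction requires. -/
theorem subsingleton_of_isDilation (F : PointedWheelᵒᵖ ⥤ ModZ)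
    (h : ∀ (k : ℕ+) (u : SimplexWheel ⥤ SimplexWheel), IsDilation u k →
      ∀ i, Subsingleton (CatCohomology ((u ⋙ ofSimplex).op ⋙ F) i)) (i : ℕ) :
    Subsingleton (CatCohomology F i) := by
  have hS := shortExact_cokernelShortComplex (coindUnit F)
  have h₂ : ∀ i, Subsingleton (CatCohomology (coindObj (ofSimplex.op ⋙ F)) i) := fun i =>
    subsingleton_coind _ i (h 1 (𝟭 _) isDilation_id i)
  induction i generalizing F with
  | zero => exact subsingleton_left_zero hS (h₂ 0)
  | succ i ih =>
    have h₃ : ∀ (k : ℕ+) (u : SimplexWheel ⥤ SimplexWheel), IsDilation u k → ∀ i,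
        Subsingleton (CatCohomology
          ((u ⋙ ofSimplex).op ⋙ (cokernelShortComplex (coindUnit F)).X₃) i) :=
      fun k u hu j => subsingleton_right (shortExact_restrict (u ⋙ ofSimplex).op hS)
        (subsingleton_of_iso (coindRestrictionIso u F)
          (subsingleton_pointwisePi _ j fun l => h _ _ (hu.comp (isDilation_dilate l)) j))
        (h k u hu (j + 1))
    refine subsingleton_left_succ hS (ih _ h₃ (shortExact_cokernelShortComplex _) fun j => ?_)
      (h₂ _)
    exact subsingleton_coind _ j (h₃ 1 (𝟭 _) isDilation_id j)

end PointedWheel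

/-! ### Pointed wheels as a model of the opposite of ΔR. -/

namespace LambdaR
open Opposite CatCohomology

/-- The class of a lift. -/
def Lift.hom {m n : LambdaR} (f : Lift m n) : m ⟶ n := Quotient.mk (Lift.setoid m n) f

theorem Lift.exists_hom_eq {m n : LambdaR} (f : m ⟶ n) : ∃ g : Lift m n, g.hom = f :=
  Quotient.exists_rep f

theorem Lift.hom_eq_iff {m n : LambdaR} {f g : Lift m n} :
    f.hom = g.hom ↔ ∃ k : ℤ, ∀ a : ℤ, g.toFun a = f.toFun a + k * (n.size : ℤ) :=
  Quotient.eq (r := Lift.setoid m n)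

theorem Lift.hom_comp_hom {m n p : LambdaR} (f : Lift m n) (g : Lift n p) :
    f.hom ≫ g.hom = (f.comp g).hom := rfl

theorem size_pos (m : LambdaR) : (0 : ℤ) < m.size := by exact_mod_cast m.size.pos

theorem vertices_map_hom {m n : LambdaR} (f : Lift m n) (a : ℤ) :
    vertices.map f.hom (show vertices.obj m from (a : ZMod m.size)) =
      ((f.toFun a : ℤ) : ZMod n.size) :=
  Lift.cast_toFun_eq f (intCast_val_eq _)

/-- The base vertex of a pointed wheel. -/
def ofPointed : PointedWheel ⥤ vertices.Elements where
  obj m := vertices.elementsMk ⟨m.size⟩ (show ZMod m.size from ((0 : ℤ) : ZMod m.size))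
  map {m n} f := ⟨Lift.hom (m := ⟨m.size⟩) (n := ⟨n.size⟩)
      ⟨f.toFun, f.degree, f.monotone, f.map_add_size⟩,
    (vertices_map_hom (m := ⟨m.size⟩) (n := ⟨n.size⟩) _ 0).trans
      (congrArg (fun a : ℤ => (a : ZMod n.size)) f.map_zero)⟩
  map_id _ := rfl
  map_comp _ _ := rfl

/-- Two lifts of a class differ by a deck transformation, and the normalisation `toFun 0 = 0` makes
it trivial. Subtracting the value at 0 normalises any lift that preserves the base vertex, hence
fullness. -/
instance : ofPointed.Faithful where
  map_injective {m n f g} h := by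
    obtain ⟨k, hk⟩ := Lift.hom_eq_iff.1 (congrArg Subtype.val h)
    refine PointedWheel.Hom.ext (funext fun a => ?_)
    have h0 := hk 0
    have hk0 : k * (n.size : ℤ) = 0 := by
      change g.toFun 0 = f.toFun 0 + k * (n.size : ℤ) at h0
      rw [f.map_zero, g.map_zero] at h0
      linarith
    have ha : g.toFun a = f.toFun a + k * (n.size : ℤ) := hk a
    rw [ha, hk0, add_zero]

instance : ofPointed.Full where
  map_surjective {m n} g := by
    obtain ⟨g, hg⟩ := g
    obtain ⟨g, rfl⟩ := Lift.exists_hom_eq g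
    have h0 : ((g.toFun 0 : ℤ) : ZMod n.size) = ((0 : ℤ) : ZMod n.size) :=
      (vertices_map_hom g 0).symm.trans hg
    obtain ⟨k, hk⟩ := (ZMod.intCast_eq_intCast_iff_dvd_sub _ _ _).1 h0
    have hk : 0 - g.toFun 0 = (n.size : ℤ) * k := hk
    refine ⟨⟨fun a => g.toFun a - g.toFun 0, g.degree, fun a b h => ?_, sub_self _, fun a => ?_⟩,
      Subtype.ext (Lift.hom_eq_iff.2 ⟨-k, fun a => ?_⟩)⟩
    · exact sub_le_sub_right (g.monotone' h) _
    · have : g.toFun (a + (m.size : ℤ)) = g.toFun a + (g.degree : ℤ) * (n.size : ℤ) :=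
        g.map_add_size' a
      rw [this]
      ring
    · change g.toFun a = g.toFun a - g.toFun 0 + -k * (n.size : ℤ)
      linarith

/-- The rotation of a wheel. -/
def rotation (m : LambdaR) (a : ℤ) : Lift m m where
  toFun b := b + a
  degree := 1
  monotone' _ _ h := add_le_add_left h a
  map_add_size' b := by
    push_cast
    ring

instance : ofPointed.EssSurj where
  mem_essImage x := by
    obtain ⟨m, v⟩ := x
    have hv : (((ZMod.val (n := m.size) v : ℕ) : ℤ) : ZMod m.size) = v := intCast_val_eq v
    let a : ℤ := ((ZMod.val (n := m.size) v : ℕ) : ℤ)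
    refine ⟨⟨m.size⟩, ⟨⟨⟨(rotation m a).hom, ?_⟩, ⟨(rotation m (-a)).hom, ?_⟩, ?_, ?_⟩⟩⟩
    · refine (vertices_map_hom (rotation m a) 0).trans ?_
      change ((0 + a : ℤ) : ZMod m.size) = v
      rw [zero_add, hv]
    · refine (congrArg (vertices.map (rotation m (-a)).hom) hv.symm).trans
        ((vertices_map_hom (rotation m (-a)) a).trans ?_)
      change ((a + -a : ℤ) : ZMod m.size) = ((0 : ℤ) : ZMod m.size)
      rw [add_neg_cancel]
    · exact Subtype.ext (congrArg Lift.hom (Lift.ext (funext fun b =>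
        show b + a + -a = b by ring) (one_mul _)))
    · exact Subtype.ext (congrArg Lift.hom (Lift.ext (funext fun b =>
        show b + -a + a = b by ring) (one_mul _)))

instance : ofPointed.IsEquivalence where

theorem subsingleton_of_pointed (F : DeltaR ⥤ ModZ) (i : ℕ)
    (h : Subsingleton (CatCohomology (ofPointed.op ⋙ F) i)) :
    Subsingleton (CatCohomology F i) :=
  (pullback_injective_of_isEquivalence ofPointed.op F i).subsingleton

end LambdaR

/-! ### Cellular cochains of the wheel and the four-term exact sequence. -/

/-- Additive functions on the oriented edges of the universal cover of a wheel that are invariant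
under deck transformations. -/
def wheelCocycleGroup (A : Type) [AddCommGroup A] (m : ℕ+) : AddSubgroup (ℤ → ℤ → A) where
  carrier := {c | (∀ a b d, c a b + c b d = c a d) ∧
    ∀ a b, c (a + (m : ℤ)) (b + (m : ℤ)) = c a b}
  zero_mem' := ⟨fun _ _ _ => add_zero _, fun _ _ => rfl⟩
  add_mem' := fun {x y} hx hy => ⟨fun a b d => by
    change x a b + y a b + (x b d + y b d) = x a d + y a d
    rw [add_add_add_comm, hx.1, hy.1], fun a b => by
    change x _ _ + y _ _ = x a b + y a b
    rw [hx.2, hy.2]⟩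
  neg_mem' := fun {x} hx => ⟨fun a b d => by
    change -x a b + -x b d = -x a d
    rw [← neg_add, hx.1], fun a b => congrArg Neg.neg (hx.2 a b)⟩

/-- The group `wheelCocycleGroup A m` as a type. -/
abbrev WheelCocycles (A : Type) [AddCommGroup A] (m : ℕ+) : Type := wheelCocycleGroup A m

namespace WheelCocycles
variable {A : Type} [AddCommGroup A] {m : ℕ+} (c : WheelCocycles A m)

@[ext]
theorem ext {c d : WheelCocycles A m} (h : ∀ a b, c.1 a b = d.1 a b) : c = d :=
  Subtype.ext (funext fun a => funext fun b => h a b)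

theorem add_apply (a b d : ℤ) : c.1 a b + c.1 b d = c.1 a d := c.2.1 a b d

theorem self (a : ℤ) : c.1 a a = 0 := by
  simpa using c.add_apply a a a

theorem eq_sub (a b : ℤ) : c.1 a b = c.1 0 b - c.1 0 a := by
  rw [← c.add_apply 0 a b]
  abel

theorem periodic (a b k : ℤ) : c.1 (a + k * (m : ℤ)) (b + k * (m : ℤ)) = c.1 a b := by
  induction k using Int.induction_on with
  | zero => simp
  | succ i ih => rw [add_one_mul, ← add_assoc, ← add_assoc, c.2.2, ih]
  | pred i ih =>
    rw [← c.2.2, ← ih]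
    ring_nf

theorem add_period (a k : ℤ) : c.1 a (a + k * (m : ℤ)) = k • c.1 0 (m : ℤ) := by
  have h0 : ∀ a : ℤ, c.1 a (a + (m : ℤ)) = c.1 0 (m : ℤ) := fun a => by
    have h := c.add_apply 0 (m : ℤ) (a + (m : ℤ))
    have h' : c.1 (m : ℤ) (a + (m : ℤ)) = c.1 0 a := by
      have := c.2.2 0 a
      rwa [zero_add] at this
    rw [h', ← c.add_apply 0 a (a + (m : ℤ)), add_comm] at h
    exact (add_left_cancel h).symm
  induction k using Int.induction_on with
  | zero => simp [c.self]
  | succ i ih =>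
    rw [← c.add_apply a (a + (i : ℤ) * (m : ℤ)), ih, add_one_mul, ← add_assoc, h0, add_one_zsmul]
  | pred i ih =>
    have h := c.add_apply a (a + (-(i : ℤ) - 1) * (m : ℤ)) (a + -(i : ℤ) * (m : ℤ))
    have h1 := h0 (a + (-(i : ℤ) - 1) * (m : ℤ))
    rw [show a + (-(i : ℤ) - 1) * (m : ℤ) + (m : ℤ) = a + -(i : ℤ) * (m : ℤ) by ring] at h1
    rw [h1, ih] at h
    rw [sub_one_zsmul, ← h, add_neg_cancel_right]

/-- The differential of a function whose increments are periodic. -/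
def ofFun (m : ℕ+) (y : ℤ → A) (z : A) (h : ∀ a, y (a + (m : ℤ)) = y a + z) :
    WheelCocycles A m :=
  ⟨fun a b => y b - y a, fun _ _ _ => by beta_reduce; abel, fun a b => by
    beta_reduce
    rw [h, h]
    abel⟩

/-- The differential of a function with prescribed values on a fundamental domain and prescribed
total increment. -/
def ofBlock (m : ℕ+) (y : ℤ → A) (z : A) : WheelCocycles A m :=
  ofFun m (fun b => (b / (m : ℤ)) • z + y (b % (m : ℤ))) z fun a => by
    have hm : (m : ℤ) ≠ 0 := by exact_mod_cast m.ne_zero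
    rw [show (a + (m : ℤ)) / (m : ℤ) = a / (m : ℤ) + 1 by
      simpa using Int.add_mul_ediv_right a 1 hm, Int.add_emod_right, add_one_zsmul]
    abel

theorem zero_apply_emod (b : ℤ) :
    (b / (m : ℤ)) • c.1 0 (m : ℤ) + c.1 0 (b % (m : ℤ)) = c.1 0 b := by
  have h := c.add_period (b % (m : ℤ)) (b / (m : ℤ))
  rw [← h, add_comm, c.add_apply, Int.emod_add_ediv_mul]

/-- Functoriality of cocycles. -/
def map {A B : Type} [AddCommGroup A] [AddCommGroup B] {m n : LambdaR}
    (f : LambdaR.Lift n m) (φ : A →+ B) (c : WheelCocycles A m.size) : WheelCocycles B n.size :=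
  ⟨fun a b => φ (c.1 (f.toFun a) (f.toFun b)), fun _ _ _ => by
    beta_reduce
    rw [← map_add, c.add_apply], fun a b => by
    beta_reduce
    rw [f.map_add_size', f.map_add_size', c.periodic]⟩

end WheelCocycles

namespace LambdaR
open Opposite CatCohomology

/-- A lift of a morphism. -/
noncomputable def someLift {m n : LambdaR} (f : m ⟶ n) : Lift m n := (Lift.exists_hom_eq f).choose

theorem someLift_hom {m n : LambdaR} (f : m ⟶ n) : (someLift f).hom = f :=
  (Lift.exists_hom_eq f).choose_spec

/-- Periodicity of cocycles makes the action independent of the lift, so `edgesObj` may use an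
arbitrary choice. -/
theorem map_cocycle_eq {A B : ModZ} {m n : LambdaR} (φ : A ⟶ B) {f g : Lift n m}
    (h : f.hom = g.hom) (c : WheelCocycles A m.size) (a b : ℤ) :
    φ (c.1 (f.toFun a) (f.toFun b)) = φ (c.1 (g.toFun a) (g.toFun b)) := by
  obtain ⟨k, hk⟩ := Lift.hom_eq_iff.1 h
  rw [hk, hk, c.periodic]

/-- The functor of invariant cocycles with values in `M`, on objects. -/
noncomputable def edgesObj (M : LambdaRᵒᵖ ⥤ ModZ) : LambdaRᵒᵖ ⥤ ModZ where
  obj m := ModuleCat.of ℤ (WheelCocycles (M.obj m) m.unop.size)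
  map {m n} f := ModZ.homMk
    (fun c : WheelCocycles (M.obj m) m.unop.size =>
      (show WheelCocycles (M.obj n) n.unop.size from
        WheelCocycles.map (someLift f.unop) (M.map f).hom.toAddMonoidHom c))
    fun _ _ => WheelCocycles.ext fun _ _ => _root_.map_add (M.map f).hom _ _
  map_id m := ModZ.hom_ext fun c => WheelCocycles.ext fun a b =>
    (map_cocycle_eq (M.map (𝟙 m)) (g := Lift.id m.unop) (someLift_hom _) c a b).trans
      (ModZ.map_id_apply M _)
  map_comp f g := ModZ.hom_ext fun c => WheelCocycles.ext fun a b =>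
    (map_cocycle_eq (M.map (f ≫ g)) (g := (someLift g.unop).comp (someLift f.unop))
      (by rw [someLift_hom, ← Lift.hom_comp_hom, someLift_hom, someLift_hom]; rfl) c a b).trans
      (ModZ.map_comp_apply M f g _)

theorem edgesObj_map_apply (M : LambdaRᵒᵖ ⥤ ModZ) {m n : LambdaRᵒᵖ} (f : m ⟶ n)
    (g : Lift n.unop m.unop) (h : g.hom = f.unop) (c : WheelCocycles (M.obj m) m.unop.size)
    (a b : ℤ) :
    (show WheelCocycles (M.obj n) n.unop.size from (edgesObj M).map f c).1 a b =
      M.map f (c.1 (g.toFun a) (g.toFun b)) :=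
  map_cocycle_eq (M.map f) ((someLift_hom _).trans h.symm) c a b

/-- The functor of invariant cocycles with values in `M`. -/
noncomputable def edges : (LambdaRᵒᵖ ⥤ ModZ) ⥤ (LambdaRᵒᵖ ⥤ ModZ) where
  obj M := edgesObj M
  map {M N} φ :=
    { app := fun m => ModZ.homMk
        (fun c : WheelCocycles (M.obj m) m.unop.size =>
          (show WheelCocycles (N.obj m) m.unop.size from
            WheelCocycles.map (Lift.id m.unop) (φ.app m).hom.toAddMonoidHom c))
        fun _ _ => WheelCocycles.ext fun _ _ => _root_.map_add (φ.app m).hom _ _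
      naturality := fun m n f => ModZ.hom_ext fun c => WheelCocycles.ext fun a b =>
        ModZ.naturality_apply φ f _ }

/-- The differential of functions on vertices. -/
noncomputable def vertexDiff (M : LambdaRᵒᵖ ⥤ ModZ) :
    Functor.Elements.coindObj vertices (jTilde ⋙ M) ⟶ edgesObj M where
  app m := ModZ.homMk
    (fun y : ∀ _ : ZMod m.unop.size, M.obj m =>
      (show WheelCocycles (M.obj m) m.unop.size from
        WheelCocycles.ofFun _ (fun a : ℤ => y a) 0 fun a => by simp))
    fun _ _ => WheelCocycles.ext fun _ _ => add_sub_add_comm _ _ _ _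
  naturality m n f := ModZ.hom_ext fun (y : ∀ _ : ZMod m.unop.size, M.obj m) =>
      WheelCocycles.ext fun a b => by
    have hf : ∀ a : ℤ, vertices.map f.unop (show vertices.obj n.unop from (a : ZMod n.unop.size)) =
        (((someLift f.unop).toFun a : ℤ) : ZMod m.unop.size) := fun a =>
      (congrArg (fun g => vertices.map g (show vertices.obj n.unop from (a : ZMod n.unop.size)))
        (someLift_hom f.unop).symm).trans (vertices_map_hom (someLift f.unop) a)
    refine Eq.trans ?_ (map_sub (M.map f).hom _ _).symm
    exact congrArg₂ (fun v w => M.map f (y v) - M.map f (y w)) (hf b) (hf a)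

theorem Lift.degree_eq {m n : LambdaR} (f : Lift m n) :
    (f.degree : ℤ) * (n.size : ℤ) = f.toFun m.size - f.toFun 0 := by
  have := f.map_add_size' 0
  rw [zero_add] at this
  linarith

theorem Lift.degree_congr {m n : LambdaR} {f g : Lift m n} (h : f.hom = g.hom) :
    f.degree = g.degree := by
  obtain ⟨k, hk⟩ := Lift.hom_eq_iff.1 h
  have h' : (f.degree : ℤ) * (n.size : ℤ) = g.degree * (n.size : ℤ) := by
    rw [f.degree_eq, g.degree_eq, hk, hk]
    ring
  exact_mod_cast mul_right_cancel₀ n.size_pos.ne' h'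

/-- The degree of maps of wheels. -/
noncomputable def degree : LambdaRᵒᵖ ⥤ SingleObj ℕ+ where
  obj _ := SingleObj.star _
  map f := (someLift f.unop).degree
  map_id m := Lift.degree_congr (g := Lift.id m.unop) (someLift_hom _)
  map_comp f g := Lift.degree_congr (g := (someLift g.unop).comp (someLift f.unop))
    (by rw [someLift_hom, ← Lift.hom_comp_hom, someLift_hom, someLift_hom]; rfl)

end LambdaR

/-- The twist of a functor by the degrees of morphisms. -/
def degreeTwist {C : Type} [SmallCategory C] (d : C ⥤ SingleObj ℕ+) (M : C ⥤ ModZ) :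
    C ⥤ ModZ where
  obj c := M.obj c
  map f := ModZ.homMk (fun x => ((show ℕ+ from d.map f) : ℕ) • M.map f x)
    fun x y => by rw [map_add, smul_add]
  map_id c := ModZ.hom_ext fun x => by
    have h : (show ℕ+ from d.map (𝟙 c)) = 1 := d.map_id c
    refine (congrArg (fun k : ℕ+ => (k : ℕ) • M.map (𝟙 c) x) h).trans ?_
    exact (one_nsmul _).trans (ModZ.map_id_apply M x)
  map_comp f g := ModZ.hom_ext fun x => by
    have h : (show ℕ+ from d.map (f ≫ g)) = (show ℕ+ from d.map g) * (show ℕ+ from d.map f) :=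
      d.map_comp f g
    refine (congrArg (fun k : ℕ+ => (k : ℕ) • M.map (f ≫ g) x) h).trans ?_
    refine Eq.trans ?_ (congrArg (fun z => ((show ℕ+ from d.map g) : ℕ) • z)
      (map_nsmul (M.map g).hom ((show ℕ+ from d.map f) : ℕ) (M.map f x)).symm)
    rw [ModZ.map_comp_apply, PNat.mul_coe, mul_smul]

namespace LambdaR
open Opposite CatCohomology

/-- The total increment of a cocycle around the wheel. -/
noncomputable def totalIncrement (M : LambdaRᵒᵖ ⥤ ModZ) : edgesObj M ⟶ degreeTwist degree M where
  app m := ModZ.homMk (fun c : WheelCocycles (M.obj m) m.unop.size =>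
    (show M.obj m from c.1 0 (m.unop.size : ℤ))) fun _ _ => rfl
  naturality m n f := ModZ.hom_ext fun (c : WheelCocycles (M.obj m) m.unop.size) => by
    let g := someLift f.unop
    -- The image of one period covers `g.degree` periods of the target; this factor is the twist.
    have h : c.1 (g.toFun 0) (g.toFun n.unop.size) =
        (g.degree : ℕ) • c.1 0 (m.unop.size : ℤ) := by
      have h1 := g.map_add_size' 0
      rw [zero_add] at h1
      rw [h1, c.add_period, natCast_zsmul]
    exact (congrArg (M.map f) h).trans (map_nsmul (M.map f).hom _ _)

end LambdaR

/-- The right half of a four-term exact sequence cut at the image of g, which is identified with the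
cokernel of f. -/
theorem shortExact_cokernel_desc {C : Type} [SmallCategory C] {M₀ M₁ M₂ M₃ : C ⥤ ModZ}
    (f : M₀ ⟶ M₁) [Mono f] (g : M₁ ⟶ M₂) (h : M₂ ⟶ M₃) (hfg : f ≫ g = 0) (hgh : g ≫ h = 0)
    (hg : ∀ c y, g.app c y = 0 → ∃ x, f.app c x = y)
    (hh : ∀ c z, h.app c z = 0 → ∃ y, g.app c y = z)
    (hs : ∀ c, Function.Surjective (h.app c)) :
    (ShortComplex.mk (Limits.cokernel.desc f g hfg) h
      ((cancel_epi (Limits.cokernel.π f)).1 (by simp [hgh]))).ShortExact := by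
  have hd : ∀ c y, (Limits.cokernel.desc f g hfg).app c ((Limits.cokernel.π f).app c y) =
      g.app c y := fun c y =>
    congrArg (fun χ : M₁ ⟶ M₂ => χ.app c y) (Limits.cokernel.π_desc f g hfg)
  have hS := shortExact_cokernelShortComplex f
  refine ShortComplex.shortExact_of_pointwise (fun c => ?_) (fun c z hz => ?_) hs
  · rw [injective_iff_map_eq_zero]
    intro x hx
    obtain ⟨y, rfl⟩ := hS.surjective_app c x
    obtain ⟨z, rfl⟩ := hg c y ((hd c y).symm.trans hx)
    exact congrArg (fun χ : M₀ ⟶ _ => χ.app c z) (cokernelShortComplex f).zero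
  · obtain ⟨y, rfl⟩ := hh c z hz
    exact ⟨(Limits.cokernel.π f).app c y, hd c y⟩

namespace LambdaR
open Opposite CatCohomology

instance (M : LambdaRᵒᵖ ⥤ ModZ) : Mono (Functor.Elements.coindUnit vertices M) :=
  ModZ.mono_of_injective _ fun _ _ _ h => congrFun h (0 : ZMod _)

/-- With zero total increment, the primitive b ↦ c(0, b) is periodic and descends to the vertices.
-/
theorem cocycle_vertex {A : Type} [AddCommGroup A] {m : ℕ+} (c : WheelCocycles A m)
    (h : c.1 0 (m : ℤ) = 0) (b : ℤ) : c.1 0 (((b : ZMod m).val : ℕ) : ℤ) = c.1 0 b := by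
  obtain ⟨k, hk⟩ := (ZMod.intCast_eq_intCast_iff_dvd_sub _ _ _).1 (intCast_val_eq (b : ZMod m))
  have hk : b - (((b : ZMod m).val : ℕ) : ℤ) = (m : ℤ) * k := hk
  have h' := c.add_period (((b : ZMod m).val : ℕ) : ℤ) k
  rw [show (((b : ZMod m).val : ℕ) : ℤ) + k * (m : ℤ) = b by linarith, h, smul_zero] at h'
  rw [← c.add_apply 0 (((b : ZMod m).val : ℕ) : ℤ) b, h', add_zero]

theorem coindUnit_vertexDiff (M : LambdaRᵒᵖ ⥤ ModZ) :
    Functor.Elements.coindUnit vertices M ≫ vertexDiff M = 0 :=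
  ModZ.natTrans_ext fun _ _ => WheelCocycles.ext fun _ _ => sub_self _

theorem vertexDiff_totalIncrement (M : LambdaRᵒᵖ ⥤ ModZ) :
    vertexDiff M ≫ totalIncrement M = 0 :=
  ModZ.natTrans_ext fun m (y : ∀ _ : ZMod m.unop.size, M.obj m) => by
    change y ((m.unop.size : ℤ) : ZMod m.unop.size) - y ((0 : ℤ) : ZMod m.unop.size) = 0
    simp

/-- The quotient of functions on vertices by constant functions is the functor of cocycles with
zero total increment. -/
noncomputable abbrev totalIncrementComplex (M : LambdaRᵒᵖ ⥤ ModZ) :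
    ShortComplex (LambdaRᵒᵖ ⥤ ModZ) :=
  ShortComplex.mk (Limits.cokernel.desc _ _ (coindUnit_vertexDiff M)) (totalIncrement M)
    ((cancel_epi (Limits.cokernel.π (Functor.Elements.coindUnit vertices M))).1
      (by simp [vertexDiff_totalIncrement]))

theorem shortExact_totalIncrementComplex (M : LambdaRᵒᵖ ⥤ ModZ) :
    (totalIncrementComplex M).ShortExact := by
  refine shortExact_cokernel_desc (Functor.Elements.coindUnit vertices M) (vertexDiff M)
    (totalIncrement M) (coindUnit_vertexDiff M) (vertexDiff_totalIncrement M) ?_ ?_ ?_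
  · intro m (y : ∀ _ : ZMod m.unop.size, M.obj m) hy
    refine ⟨y 0, funext fun (v : ZMod m.unop.size) => ?_⟩
    have h := congrArg
      (fun c : WheelCocycles (M.obj m) m.unop.size => c.1 ((v.val : ℕ) : ℤ) 0) hy
    have h : y ((0 : ℤ) : ZMod m.unop.size) - y (((v.val : ℕ) : ℤ) : ZMod m.unop.size) = 0 := h
    rw [intCast_val_eq, Int.cast_zero, sub_eq_zero] at h
    exact h
  · intro m (c : WheelCocycles (M.obj m) m.unop.size) hc
    have hc : c.1 0 (m.unop.size : ℤ) = 0 := hc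
    refine ⟨fun v : ZMod m.unop.size => c.1 0 ((v.val : ℕ) : ℤ), WheelCocycles.ext fun a b => ?_⟩
    rw [c.eq_sub a b, ← cocycle_vertex c hc a, ← cocycle_vertex c hc b]
    rfl
  · intro m (x : M.obj m)
    have hm : (m.unop.size : ℤ) ≠ 0 := m.unop.size_pos.ne'
    -- The differential of a step function that jumps by x once per period.
    refine ⟨WheelCocycles.ofBlock m.unop.size (fun _ => 0) x, ?_⟩
    change (((m.unop.size : ℤ) / (m.unop.size : ℤ)) • x + 0) -
      (((0 : ℤ) / (m.unop.size : ℤ)) • x + 0) = x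
    rw [Int.ediv_self hm, Int.zero_ediv]
    simp

instance : edges.PreservesZeroMorphisms where
  map_zero _ _ := ModZ.natTrans_ext fun _ _ => rfl

theorem shortExact_edges {S : ShortComplex (LambdaRᵒᵖ ⥤ ModZ)} (hS : S.ShortExact) :
    (S.map edges).ShortExact := by
  refine ShortComplex.shortExact_of_pointwise (fun m => ?_) (fun m => ?_) (fun m => ?_)
  · intro c d h
    exact WheelCocycles.ext fun a b => hS.injective_app m
      (congrArg (fun c : WheelCocycles (S.X₂.obj m) m.unop.size => c.1 a b) h)
  · intro (c : WheelCocycles (S.X₂.obj m) m.unop.size) hc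
    choose y hy using fun a b => hS.exact_app m (c.1 a b)
      (congrArg (fun c : WheelCocycles (S.X₃.obj m) m.unop.size => c.1 a b) hc)
    refine ⟨(show WheelCocycles (S.X₁.obj m) m.unop.size from
      ⟨y, fun a b d => hS.injective_app m ?_, fun a b => hS.injective_app m ?_⟩),
      WheelCocycles.ext hy⟩
    · rw [map_add, hy, hy, hy, c.add_apply]
    · rw [hy, hy, c.2.2]
  · intro (c : WheelCocycles (S.X₃.obj m) m.unop.size)
    choose y hy using fun a => hS.surjective_app m (c.1 0 a)
    -- Values on a fundamental domain and the total increment can be lifted independently. The lift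
    -- y 0 of zero need not vanish, since only differences enter.
    refine ⟨WheelCocycles.ofBlock m.unop.size y (y m.unop.size), WheelCocycles.ext fun a b => ?_⟩
    have h : ∀ b : ℤ, S.g.app m ((b / (m.unop.size : ℤ)) • y m.unop.size +
        y (b % (m.unop.size : ℤ))) = c.1 0 b := fun b => by
      rw [map_add, map_zsmul, hy, hy, c.zero_apply_emod]
    refine (map_sub (S.g.app m).hom _ _).trans ?_
    refine (congrArg₂ (· - ·) (h b) (h a)).trans (c.eq_sub a b).symm

/-- Cocycles with values in functions on vertices. -/
noncomputable def edgesCoindIso (M : LambdaRᵒᵖ ⥤ ModZ) :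
    edgesObj (Functor.Elements.coindObj vertices (jTilde ⋙ M)) ≅
      Functor.Elements.coindObj vertices (jTilde ⋙ edgesObj M) where
  hom :=
    { app := fun m => ModZ.homMk
        (fun (c : WheelCocycles (∀ _ : vertices.obj m.unop, M.obj m) m.unop.size)
          (v : vertices.obj m.unop) =>
          (show WheelCocycles (M.obj m) m.unop.size from
            ⟨fun a b => c.1 a b v, fun a b d => congrFun (c.2.1 a b d) v,
              fun a b => congrFun (c.2.2 a b) v⟩)) fun _ _ => rfl
      naturality := fun _ _ _ => rfl }
  inv :=
    { app := fun m => ModZ.homMk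
        (fun y : ∀ _ : vertices.obj m.unop, WheelCocycles (M.obj m) m.unop.size =>
          (show WheelCocycles (∀ _ : vertices.obj m.unop, M.obj m) m.unop.size from
            ⟨fun a b v => (y v).1 a b, fun a b d => funext fun v => (y v).2.1 a b d,
              fun a b => funext fun v => (y v).2.2 a b⟩)) fun _ _ => rfl
      naturality := fun _ _ _ => rfl }
  hom_inv_id := rfl
  inv_hom_id := rfl

end LambdaR

/-! ### Truncation of cocycles and acyclicity of E(M). -/

namespace WheelCocycles
variable {A : Type} [AddCommGroup A] {m : ℕ+} (c : WheelCocycles A m)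

/-- The truncation of a cocycle on a fundamental domain. -/
def truncate (t : ℤ) : WheelCocycles A m :=
  ofBlock m (fun r => c.1 0 (min r (max 0 (min t m)))) (c.1 0 (max 0 (min t m)))

/-- The block formula also holds at the closed end r = m. This is needed because a degree-one map
may send a vertex before the end of a period to the end of the target period. -/
theorem ofBlock_add_mul (y : ℤ → A) (z : A) (hy0 : y 0 = 0) (hy : y m = z) (q r : ℤ) (h0 : 0 ≤ r)
    (h : r ≤ m) : ((r + q * m) / (m : ℤ)) • z + y ((r + q * m) % (m : ℤ)) = q • z + y r := by
  have hm : (0 : ℤ) < m := by exact_mod_cast m.pos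
  rw [Int.add_mul_ediv_right _ _ hm.ne', Int.add_mul_emod_self_right]
  rcases h.lt_or_eq with h | rfl
  · rw [Int.ediv_eq_zero_of_lt h0 h, Int.emod_eq_of_lt h0 h, zero_add]
  · rw [Int.ediv_self hm.ne', Int.emod_self, hy, hy0, add_zero, add_comm 1 q, add_one_zsmul]

/-- Degree one is essential: f then carries one period into one period, and monotonicity lets it
commute with the min and max that define the truncation. -/
theorem truncate_map {A B : Type} [AddCommGroup A] [AddCommGroup B] {m n : LambdaR}
    (f : LambdaR.Lift n m) (hf : f.degree = 1) (hf0 : f.toFun 0 = 0) (φ : A →+ B)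
    (c : WheelCocycles A m.size) (t : ℤ) :
    (map f φ c).truncate t = map f φ (c.truncate (f.toFun t)) := by
  have hn := n.size_pos
  have hm := m.size_pos
  have hfn : f.toFun n.size = m.size := by simpa [hf, hf0] using f.map_add_size' 0
  have ht : f.toFun (max 0 (min t n.size)) = max 0 (min (f.toFun t) m.size) := by
    rw [f.monotone'.map_max, f.monotone'.map_min, hf0, hfn]
  have key : ∀ b : ℤ,
      (b / (n.size : ℤ)) • (map f φ c).1 0 (max 0 (min t n.size)) +
        (map f φ c).1 0 (min (b % (n.size : ℤ)) (max 0 (min t n.size))) =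
      φ ((f.toFun b / (m.size : ℤ)) • c.1 0 (max 0 (min (f.toFun t) m.size)) +
        c.1 0 (min (f.toFun b % (m.size : ℤ)) (max 0 (min (f.toFun t) m.size)))) := by
    intro b
    have hb0 := Int.emod_nonneg b hn.ne'
    have hb1 := (Int.emod_lt_of_pos b hn).le
    have hb : f.toFun b = f.toFun (b % (n.size : ℤ)) + b / (n.size : ℤ) * (m.size : ℤ) := by
      have h := f.map_add_mul (b % (n.size : ℤ)) (b / (n.size : ℤ))
      rw [Int.emod_add_ediv_mul, hf] at h
      simpa using h
    have h0 := f.monotone' hb0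
    have h1 := f.monotone' hb1
    rw [hf0] at h0
    rw [hfn] at h1
    rw [hb, ofBlock_add_mul (m := m.size)
      (fun r => c.1 0 (min r (max 0 (min (f.toFun t) m.size)))) _ ?_ ?_ _ _ h0 h1, _root_.map_add,
      map_zsmul]
    · change (b / (n.size : ℤ)) • φ (c.1 (f.toFun 0) (f.toFun (max 0 (min t n.size)))) +
        φ (c.1 (f.toFun 0) (f.toFun (min (b % (n.size : ℤ)) (max 0 (min t n.size))))) = _
      rw [hf0, f.monotone'.map_min, ht]
    · simp [c.self]
    · rw [min_eq_right (max_le hm.le (min_le_right _ _))]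
  refine ext fun a b => ?_
  refine (congrArg₂ (· - ·) (key b) (key a)).trans ?_
  exact (map_sub φ _ _).symm

theorem truncate_zero : c.truncate 0 = 0 := by
  have hm : (0 : ℤ) < m := by exact_mod_cast m.pos
  have h : ∀ b : ℤ, (b / (m : ℤ)) • c.1 0 (max 0 (min 0 m)) +
      c.1 0 (min (b % (m : ℤ)) (max 0 (min 0 m))) = 0 := fun b => by
    have := Int.emod_nonneg b hm.ne'
    simp [c.self, hm.le, this]
  exact ext fun a b => (congrArg₂ (· - ·) (h b) (h a)).trans (sub_self 0)

theorem truncate_size : c.truncate m = c := by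
  have hm : (0 : ℤ) < m := by exact_mod_cast m.pos
  have h : ∀ b : ℤ, (b / (m : ℤ)) • c.1 0 (max 0 (min (m : ℤ) m)) +
      c.1 0 (min (b % (m : ℤ)) (max 0 (min (m : ℤ) m))) = c.1 0 b := fun b => by
    have := (Int.emod_lt_of_pos b hm).le
    rw [min_self, max_eq_right hm.le, min_eq_left this, c.zero_apply_emod]
  exact ext fun a b => (congrArg₂ (· - ·) (h b) (h a)).trans (c.eq_sub a b).symm

theorem truncate_add (d : WheelCocycles A m) (t : ℤ) :
    (c + d).truncate t = c.truncate t + d.truncate t := by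
  refine ext fun a b => ?_
  change (_ • (c.1 0 _ + d.1 0 _) + (c.1 0 _ + d.1 0 _)) -
    (_ • (c.1 0 _ + d.1 0 _) + (c.1 0 _ + d.1 0 _)) =
    ((_ • c.1 0 _ + c.1 0 _) - (_ • c.1 0 _ + c.1 0 _)) +
    ((_ • d.1 0 _ + d.1 0 _) - (_ • d.1 0 _ + d.1 0 _))
  rw [smul_add, smul_add]
  abel

end WheelCocycles

namespace LambdaR
open Opposite CatCohomology SimplexWheel PointedWheel

/-- The wheel obtained from a pointed wheel by a dilation. -/
abbrev ofDilation (u : SimplexWheel ⥤ SimplexWheel) : SimplexWheel ⥤ LambdaR :=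
  (u ⋙ ofSimplex) ⋙ ofPointed ⋙ CategoryOfElements.π vertices

/-- The contraction of the functor of cocycles. -/
noncomputable def edgesContraction {u : SimplexWheel ⥤ SimplexWheel} {k : ℕ+}
    (hu : IsDilation u k) (M : LambdaRᵒᵖ ⥤ ModZ) :
    (ofDilation u).op ⋙ edgesObj M ⟶ paths.obj ((ofDilation u).op ⋙ edgesObj M) where
  app m := ModZ.homMk
    (fun (c : WheelCocycles (M.obj (op ((ofDilation u).obj m.unop))) (u.obj m.unop).size)
      (t : ℤ) => c.truncate t) fun c d => funext fun t => c.truncate_add d t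
  naturality m n f := ModZ.hom_ext fun
      (c : WheelCocycles (M.obj (op ((ofDilation u).obj m.unop))) (u.obj m.unop).size) =>
      funext fun t => by
    let g : Lift ((ofDilation u).obj n.unop) ((ofDilation u).obj m.unop) :=
      ⟨(u.map f.unop).toFun, 1, (u.map f.unop).monotone, fun a => by
        rw [PNat.one_coe, Nat.cast_one, one_mul]
        exact (u.map f.unop).map_add_size a⟩
    have hg : ∀ c : WheelCocycles (M.obj (op ((ofDilation u).obj m.unop))) (u.obj m.unop).size,
        (edgesObj M).map ((ofDilation u).map f.unop).op c =
          WheelCocycles.map g (M.map ((ofDilation u).map f.unop).op).hom.toAddMonoidHom c :=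
      fun c => WheelCocycles.ext fun a b =>
        edgesObj_map_apply M ((ofDilation u).map f.unop).op g rfl c a b
    refine (congrArg (fun c : WheelCocycles (M.obj (op ((ofDilation u).obj n.unop)))
      (u.obj n.unop).size => c.truncate t) (hg c)).trans ?_
    refine (WheelCocycles.truncate_map g rfl (u.map f.unop).map_zero _ c t).trans ?_
    refine (hg _).symm.trans ?_
    exact congrArg (fun t => (edgesObj M).map ((ofDilation u).map f.unop).op (c.truncate t))
      (hu.map_toFun f.unop t)

theorem subsingleton_edges_dilation {u : SimplexWheel ⥤ SimplexWheel} {k : ℕ+}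
    (hu : IsDilation u k) (M : LambdaRᵒᵖ ⥤ ModZ) (i : ℕ) :
    Subsingleton (CatCohomology ((ofDilation u).op ⋙ edgesObj M) i) := by
  refine subsingleton_of_forall_eq 0 fun e => ?_
  have h1 : edgesContraction hu M ≫ (evalPath (k : ℕ)).app _ = 𝟙 _ :=
    ModZ.natTrans_ext fun m
        (c : WheelCocycles (M.obj (op ((ofDilation u).obj m.unop))) (u.obj m.unop).size) => by
      have h : ((k : ℕ) : ℤ) * (m.unop.size : ℤ) = (u.obj m.unop).size := by
        rw [hu.size_obj]
        push_cast
        rfl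
      exact (congrArg c.truncate h).trans c.truncate_size
  have h0 : edgesContraction hu M ≫ (evalPath 0).app _ = 0 :=
    ModZ.natTrans_ext fun m
        (c : WheelCocycles (M.obj (op ((ofDilation u).obj m.unop))) (u.obj m.unop).size) =>
      (congrArg c.truncate (zero_mul _)).trans c.truncate_zero
  rw [← CatCohomology.map_id _ e, ← h1, map_homotopy, h0, CatCohomology.map_zero]

theorem subsingleton_edges_deltaR (M : LambdaRᵒᵖ ⥤ ModZ) (i : ℕ) :
    Subsingleton (CatCohomology (jTilde ⋙ edgesObj M) i) :=
  subsingleton_of_pointed _ _ (subsingleton_of_isDilation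
    (ofPointed.op ⋙ jTilde ⋙ edgesObj M) (fun _ _ hu i => subsingleton_edges_dilation hu M i) i)

/-- E is exact and commutes with j_*j^*, so E(M) embeds in the coinduction of a functor with no
cohomology on ΔR. The cokernel is E of the cokernel of the unit, which allows induction on the
degree. -/
theorem subsingleton_edges (M : LambdaRᵒᵖ ⥤ ModZ) (i : ℕ) :
    Subsingleton (CatCohomology (edgesObj M) i) := by
  have hS := shortExact_edges
    (shortExact_cokernelShortComplex (Functor.Elements.coindUnit vertices M))
  have h₂ : ∀ i, Subsingleton (CatCohomology
      (edgesObj (Functor.Elements.coindObj vertices (jTilde ⋙ M))) i) := fun i =>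
    subsingleton_of_iso (edgesCoindIso M)
      (Functor.Elements.subsingleton_coind vertices _ i (subsingleton_edges_deltaR M i))
  induction i generalizing M with
  | zero => exact subsingleton_left_zero hS (h₂ 0)
  | succ i ih =>
    refine subsingleton_left_succ hS (ih _ (shortExact_edges (shortExact_cokernelShortComplex _))
      fun i => ?_) (h₂ _)
    exact subsingleton_of_iso (edgesCoindIso _)
      (Functor.Elements.subsingleton_coind vertices _ i (subsingleton_edges_deltaR _ i))

end LambdaR

/-! ### Reduction to torsion coefficients. -/

section ProfiniteCompletion
variable {C : Type} [SmallCategory C]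

/-- The multiples of `N`. -/
def multiples (N : ℕ) (A : Type) [AddCommGroup A] : AddSubgroup A where
  carrier := {x | ∃ b : A, x = N • b}
  zero_mem' := ⟨0, (smul_zero _).symm⟩
  add_mem' := fun ⟨a, ha⟩ ⟨b, hb⟩ => ⟨a + b, by rw [ha, hb, smul_add]⟩
  neg_mem' := fun ⟨b, hb⟩ => ⟨-b, by rw [hb, smul_neg]⟩

theorem multiples_le {A : Type} [AddCommGroup A] {m n : ℕ} (h : m ∣ n) :
    multiples n A ≤ multiples m A := by
  obtain ⟨k, rfl⟩ := h
  rintro x ⟨b, rfl⟩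
  exact ⟨k • b, mul_smul _ _ _⟩

/-- The reduction of a functor modulo `N`. -/
def modMultiples (N : ℕ) (M : C ⥤ ModZ) : C ⥤ ModZ where
  obj c := ModuleCat.of ℤ (M.obj c ⧸ multiples N (M.obj c))
  map {c d} f := ModZ.homMk (QuotientAddGroup.map (multiples N (M.obj c)) (multiples N (M.obj d))
    (M.map f).hom.toAddMonoidHom fun _ ⟨b, hb⟩ =>
    ⟨M.map f b, (congrArg (M.map f) hb).trans (map_nsmul (M.map f).hom N b)⟩)
    (_root_.map_add _)
  map_id c := ModZ.hom_ext fun x => by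
    induction x using QuotientAddGroup.induction_on with | H x => ?_
    exact congrArg _ (ModZ.map_id_apply M x)
  map_comp f g := ModZ.hom_ext fun x => by
    induction x using QuotientAddGroup.induction_on with | H x => ?_
    exact congrArg _ (ModZ.map_comp_apply M f g x)

theorem nsmul_modMultiples (N : ℕ) (M : C ⥤ ModZ) (c : C) (x : (modMultiples N M).obj c) :
    N • x = 0 := by
  induction x using QuotientAddGroup.induction_on with | H x => ?_
  exact (QuotientAddGroup.eq_zero_iff _).2 ⟨x, rfl⟩

/-- The reduction map. -/
def toModMultiples (N : ℕ) (M : C ⥤ ModZ) : M ⟶ modMultiples N M where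
  app c := ModZ.homMk (QuotientAddGroup.mk' (multiples N (M.obj c))) (_root_.map_add _)
  naturality _ _ _ := rfl

theorem toModMultiples_eq_iff {N : ℕ} {M : C ⥤ ModZ} {c : C} {x y : M.obj c} :
    (toModMultiples N M).app c x = (toModMultiples N M).app c y ↔
      x - y ∈ multiples N (M.obj c) :=
  (QuotientAddGroup.eq_iff_sub_mem)

theorem toModMultiples_surjective (N : ℕ) (M : C ⥤ ModZ) (c : C) :
    Function.Surjective ((toModMultiples N M).app c) :=
  QuotientAddGroup.mk_surjective

/-- The reduction map between quotients. -/
def reduceMultiples {m n : ℕ} (h : m ∣ n) (M : C ⥤ ModZ) :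
    modMultiples n M ⟶ modMultiples m M where
  app c := ModZ.homMk (QuotientAddGroup.map _ _ (AddMonoidHom.id _) (multiples_le h))
    (_root_.map_add _)
  naturality c d f := ModZ.hom_ext fun x => by
    induction x using QuotientAddGroup.induction_on with | H x => ?_
    rfl

/-- The presentation of the inverse limit of the reductions modulo a sequence of integers. -/
def completionComplex {a : ℕ → ℕ} (ha : ∀ j, a j ∣ a (j + 1)) (M : C ⥤ ModZ) :
    ShortComplex (C ⥤ ModZ) :=
  ShortComplex.mk
    (pointwisePi.lift fun j : ℕ => toModMultiples (a j) M)
    (pointwisePi.lift fun j : ℕ => pointwisePi.proj (fun j : ℕ => modMultiples (a j) M) j -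
      pointwisePi.proj (fun j : ℕ => modMultiples (a j) M) (j + 1) ≫
        reduceMultiples (ha j) M)
    (ModZ.natTrans_ext fun c x => funext fun j =>
      sub_self ((toModMultiples (a j) M).app c x))

/-- The sequence a is cofinal for divisibility, so M is the limit of the tower M/a_j. The reductions
are surjective, so lim^1 vanishes. -/
theorem shortExact_completionComplex {a : ℕ → ℕ} (ha : ∀ j, a j ∣ a (j + 1))
    (ha0 : ∀ j, 0 < a j) (had : ∀ n, 0 < n → n ∣ a n) {M : C ⥤ ModZ}
    (hM : ProfinitelyComplete M) : (completionComplex ha M).ShortExact := by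
  refine ShortComplex.shortExact_of_pointwise (fun c => ?_) (fun c => ?_) (fun c => ?_)
  · rw [injective_iff_map_eq_zero]
    intro (x : M.obj c) hx
    obtain ⟨_, -, hu⟩ := hM c (fun _ => 0) fun _ _ _ => ⟨0, by simp⟩
    refine (hu x fun n => ?_).trans (hu 0 fun n => ⟨0, by simp⟩).symm
    have h : x ∈ multiples (a n) (M.obj c) :=
      (QuotientAddGroup.eq_zero_iff _).1 (congrFun hx (n : ℕ))
    obtain ⟨b, hb⟩ := multiples_le (had n n.pos) h
    exact ⟨b, by rw [sub_zero, hb]⟩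
  · intro (z : ∀ j : ℕ, (modMultiples (a j) M).obj c) hz
    choose x hx using fun j => toModMultiples_surjective (a j) M c (z j)
    have h1 : ∀ j, x (j + 1) - x j ∈ multiples (a j) (M.obj c) := fun j => by
      have h : z j - (reduceMultiples (ha j) M).app c (z (j + 1))
          = 0 := congrFun hz j
      rw [sub_eq_zero, ← hx, ← hx] at h
      exact toModMultiples_eq_iff.1 h.symm
    have hdvd : ∀ j l, j ≤ l → a j ∣ a l := fun j l h => by
      induction l, h using Nat.le_induction with
      | base => exact dvd_rfl
      | succ l h ih => exact ih.trans (ha l)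
    have h2 : ∀ j l, j ≤ l → x l - x j ∈ multiples (a j) (M.obj c) := fun j l h => by
      induction l, h using Nat.le_induction with
      | base => simp
      | succ l h ih =>
        rw [← sub_add_sub_cancel _ (x l)]
        exact add_mem (multiples_le (hdvd j l h) (h1 l)) ih
    obtain ⟨y, hy, -⟩ := hM c (fun n => x n) fun m n h =>
      multiples_le (had m m.pos) (h2 m n (Nat.le_of_dvd n.pos
        (PNat.dvd_iff.1 h)))
    refine ⟨y, funext fun j => ?_⟩
    rw [← hx j]
    refine toModMultiples_eq_iff.2 ?_
    -- Completeness is applied to the family n ↦ x n and controls y - x n modulo n only, so y and x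
    -- j are compared modulo a j through the index a j ≥ j.
    rw [← sub_add_sub_cancel _ (x (a j))]
    refine add_mem (hy ⟨a j, ha0 j⟩) (h2 j _ ?_)
    rcases j.eq_zero_or_pos with rfl | hj
    · exact Nat.zero_le _
    · exact Nat.le_of_dvd (ha0 j) (had j hj)
  · intro (z : ∀ j : ℕ, (modMultiples (a j) M).obj c)
    choose x hx using fun j => toModMultiples_surjective (a j) M c (z j)
    -- Negative partial sums solve w_j - w_(j+1) = z_j by telescoping.
    refine ⟨fun j => (toModMultiples (a j) M).app c (-∑ i ∈ Finset.range j, x i),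
      funext fun j => ?_⟩
    rw [← hx j]
    refine (map_sub ((toModMultiples (a j) M).app c).hom _ _).symm.trans
      (congrArg ((toModMultiples (a j) M).app c) ?_)
    change -∑ i ∈ Finset.range j, x i - -∑ i ∈ Finset.range (j + 1), x i = x j
    rw [Finset.sum_range_succ]
    abel

theorem CatCohomology.subsingleton_of_profinitelyComplete {M : C ⥤ ModZ}
    (hM : ProfinitelyComplete M)
    (h : ∀ (N : ℕ+) i, Subsingleton (CatCohomology (modMultiples N M) i)) (i : ℕ) :
    Subsingleton (CatCohomology M i) := by
  have hS := shortExact_completionComplex (a := Nat.factorial)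
    (fun j => Nat.factorial_dvd_factorial j.le_succ) Nat.factorial_pos
    (fun n hn => Nat.dvd_factorial hn le_rfl) hM
  have hpi : ∀ i, Subsingleton
      (CatCohomology (pointwisePi fun j : ℕ => modMultiples j.factorial M) i) := fun i =>
    subsingleton_pointwisePi _ i fun j => h ⟨j.factorial, j.factorial_pos⟩ i
  cases i with
  | zero => exact subsingleton_left_zero hS (hpi 0)
  | succ i => exact subsingleton_left_succ hS (hpi i) (hpi (i + 1))

/-- Twists commute with reduction. -/
def modMultiplesTwistIso (d : C ⥤ SingleObj ℕ+) (N : ℕ) (M : C ⥤ ModZ) :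
    modMultiples N (degreeTwist d M) ≅ degreeTwist d (modMultiples N M) :=
  NatIso.ofComponents (fun _ => Iso.refl _) fun f => ModZ.hom_ext fun x => by
    induction x using QuotientAddGroup.induction_on with | H x => ?_
    rfl

theorem CatCohomology.subsingleton_degreeTwist (d : C ⥤ SingleObj ℕ+)
    (hd : ∀ (N : ℕ+) (M : C ⥤ ModZ), (∀ c (x : M.obj c), (N : ℕ) • x = 0) →
      ∀ i, Subsingleton (CatCohomology (degreeTwist d M) i))
    {M : C ⥤ ModZ} (hM : ProfinitelyComplete M) (i : ℕ) :
    Subsingleton (CatCohomology (degreeTwist d M) i) :=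
  subsingleton_of_profinitelyComplete (M := degreeTwist d M) hM
    (fun N i => subsingleton_of_iso (modMultiplesTwistIso d N M)
      (hd N _ (nsmul_modMultiples N M) i)) i

end ProfiniteCompletion

/-! ### Vanishing over [1/ℕ*]. -/

section SingleObject
open CatCohomology

theorem natCast_mul_smul_eq {A : Type*} [AddCommGroup A] (h : Module ℤ A) (n : ℕ) (r : ℤ)
    (y : A) : h.smul ((n : ℤ) * r) y = n • h.smul r y := by
  rw [int_smul_eq_zsmul h, int_smul_eq_zsmul h, mul_zsmul, natCast_zsmul]

/-- Tensoring with `tateTwist` is twisting by degrees. -/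
noncomputable def tensorTateTwistIso (M : SingleObj ℕ+ ⥤ ModZ) :
    M ⊗ tateTwist ≅ degreeTwist (𝟭 _) M :=
  NatIso.ofComponents (fun c => ρ_ (M.obj c)) fun {c d} f => by
    refine ModuleCat.MonoidalCategory.tensor_ext ?_
    intro (x : M.obj c) (r : ℤ)
    refine (ModuleCat.MonoidalCategory.rightUnitor_hom_apply (M := M.obj d) (M.map f x)
      (tateTwist.map f r)).trans ?_
    refine Eq.trans ?_ (congrArg ((degreeTwist (𝟭 _) M).map f)
      (ModuleCat.MonoidalCategory.rightUnitor_hom_apply (M := M.obj c) x r)).symm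
    refine (natCast_mul_smul_eq (M.obj d).isModule ((show ℕ+ from f) : ℕ) r (M.map f x)).trans ?_
    exact congrArg (((show ℕ+ from f) : ℕ) • ·) ((M.map f).hom.map_smul' r x).symm

/-- By commutativity, N defines a natural endomorphism θ of the identity functor, which acts
trivially on cohomology. On the twist it acts by N • M(N) = 0. -/
theorem subsingleton_degreeTwist_singleObj (N : ℕ+) (M : SingleObj ℕ+ ⥤ ModZ)
    (h : ∀ c (x : M.obj c), (N : ℕ) • x = 0) (i : ℕ) :
    Subsingleton (CatCohomology (degreeTwist (𝟭 _) M) i) := by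
  refine subsingleton_of_forall_eq 0 fun e => ?_
  let θ : 𝟭 (SingleObj ℕ+) ⟶ 𝟭 (SingleObj ℕ+) :=
    { app := fun _ => (show ℕ+ from N)
      naturality := fun _ _ f => mul_comm N (show ℕ+ from f) }
  have h0 : Functor.whiskerRight θ (degreeTwist (𝟭 _) M) = 0 :=
    ModZ.natTrans_ext fun c x => h c _
  rw [← pullback_id (degreeTwist (𝟭 _) M) e]
  refine (map_whiskerRight_pullback θ _ e).symm.trans ?_
  rw [h0, CatCohomology.map_zero]

end SingleObject

/-! ### Vanishing of twisted cohomology and the comparison theorem. -/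

namespace LambdaR
open CatCohomology Opposite

/-- The N-fold covering has degree N, so the twist makes it act as N times a map, which is zero on
N-torsion. -/
theorem subsingleton_degreeTwist_deltaR (N : ℕ+) (M : LambdaRᵒᵖ ⥤ ModZ)
    (h : ∀ c (x : M.obj c), (N : ℕ) • x = 0) (i : ℕ) :
    Subsingleton (CatCohomology (jTilde ⋙ degreeTwist degree M) i) := by
  refine subsingleton_of_pointed _ _ (PointedWheel.subsingleton_of_covering_eq_zero N
    (ofPointed.op ⋙ jTilde ⋙ degreeTwist degree M) (fun m x => ?_) i)
  let f := jTilde.map (ofPointed.map ((PointedWheel.dilationToId N).app m)).op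
  let g : Lift ⟨N * m.size⟩ ⟨m.size⟩ :=
    ⟨fun a => a, N, fun _ _ h => h, ((PointedWheel.dilationToId N).app m).map_add_size⟩
  have hf : (someLift f.unop).degree = N := Lift.degree_congr (g := g) (someLift_hom _)
  refine Eq.trans ?_ (h _ (M.map f x))
  exact congrArg (fun k : ℕ+ => (k : ℕ) • M.map f x) hf

/-- With both middle terms of the four-term sequence acyclic, the degree drops by two while M is
replaced by its twist, still killed by N. Degrees 0 and 1 vanish directly. -/
theorem subsingleton_degreeTwist_of_torsion (N : ℕ+) (M : LambdaRᵒᵖ ⥤ ModZ)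
    (h : ∀ c (x : M.obj c), (N : ℕ) • x = 0) (i : ℕ) :
    Subsingleton (CatCohomology (degreeTwist degree M) i) := by
  induction i using Nat.strong_induction_on generalizing M with
  | h i ih =>
    have hA := shortExact_cokernelShortComplex
      (Functor.Elements.coindUnit vertices (degreeTwist degree M))
    have hA₂ : ∀ i, Subsingleton (CatCohomology
        (Functor.Elements.coindObj vertices (jTilde ⋙ degreeTwist degree M)) i) := fun i =>
      Functor.Elements.subsingleton_coind _ _ i (subsingleton_degreeTwist_deltaR N M h i)
    have hB := shortExact_totalIncrementComplex (degreeTwist degree M)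
    have hB₂ := subsingleton_edges (degreeTwist degree M)
    match i with
    | 0 => exact subsingleton_left_zero hA (hA₂ 0)
    | 1 => exact subsingleton_left_succ hA (subsingleton_left_zero hB (hB₂ 0)) (hA₂ 1)
    | i + 2 =>
      exact subsingleton_left_succ hA (subsingleton_left_succ hB
        (ih i (by omega) (degreeTwist degree M) h) (hB₂ _)) (hA₂ _)

theorem bijective_pullback_jTilde {M : LambdaRᵒᵖ ⥤ ModZ} (hM : ProfinitelyComplete M) (i : ℕ) :
    Function.Bijective (pullback jTilde M i) := by
  have hT := CatCohomology.subsingleton_degreeTwist degree subsingleton_degreeTwist_of_torsion hM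
  have hB := shortExact_totalIncrementComplex M
  refine Functor.Elements.bijective_pullback_of_bijective_unit vertices M i
    (map_f_bijective (shortExact_cokernelShortComplex (Functor.Elements.coindUnit vertices M))
      (fun j => ?_) i)
  cases j with
  | zero => exact subsingleton_left_zero hB (subsingleton_edges M 0)
  | succ j => exact subsingleton_left_succ hB (hT j) (subsingleton_edges M (j + 1))

end LambdaR

theorem proposition1p14 :
    (∀ M : LambdaRᵒᵖ ⥤ ModuleCat.{0} ℤ, ProfinitelyComplete M →
      ∀ i : ℕ, Function.Bijective (CatCohomology.pullback jTilde M i)) ∧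
    (∀ N : SingleObj ℕ+ ⥤ ModuleCat.{0} ℤ, ProfinitelyComplete N →
      ∀ i : ℕ, Subsingleton (CatCohomology (N ⊗ tateTwist) i)) :=
  ⟨fun _ hM i => LambdaR.bijective_pullback_jTilde hM i, fun N hN i =>
    CatCohomology.subsingleton_of_iso (tensorTateTwistIso N)
      (CatCohomology.subsingleton_degreeTwist (𝟭 _) subsingleton_degreeTwist_singleObj hN i)⟩
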